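/- Let $p,q$ be real numbers with $0<p<q<1$. Let $\mathcal A=(A_n)_{n\in\mathbb Z}$ be a Bernoulli point process of parameter $p$ on $\mathbb Z$: each integer is a point with probability $p$, independently of the other integers, and the points are numbered in increasing order so that $A_0\le 0<A_1$. Let $s=(s_n)_{n\in\mathbb Z}$ be a sequence of i.i.d. random variables, independent of $\mathcal A$, with $P\{s_n=k\}=(1-q)^{k-1}q$ for $k\ge 1$. For $n\in\mathbb Z$ put $$D_n=\sup_{k\le n}\Bigl[A_k+\sum_{i=k}^n s_i\Bigr],\qquad r_n=\min(D_n,A_{n+1})-A_n$$ (in the single-server FIFO queue with arrival times $A_n$ and service times $s_n$, $D_n$ is the departure time of customer $n$ and $r_n$ is the time it spends at the very back of the queue). Then, almost surely, all $D_n$ are finite, $(D_n)_n$ is strictly increasing and unbounded in both directions, and all $r_n$ are positive; and the marked point process $(\mathcal D,r)=(D_n,r_n)_{n\in\mathbb Z}$ has the same law as the marked point process $(\mathcal A,s)=(A_n,s_n)_{n\in\mathbb Z}$. Here marked point processes are considered up to a translation of the indices, that is, the random counting measures $\sum_n\delta_{(D_n,r_n)}$ and $\sum_n\delta_{(A_n,s_n)}$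 on $\mathbb R\times\mathbb R$ have the same law. -/

import Mathlib

open MeasureTheory ProbabilityTheory Filter

noncomputable section

namespace GeomQueue

/-- The quantity `A_k + s_k + ⋯ + s_n` whose supremum over `k ≤ n` is the `n`-th departure time. -/
def partialLoad (A s : ℤ → ℝ) (n k : ℤ) : ℝ :=
  A k + ∑ i ∈ Finset.Icc k n, s i

/-- All the suprema `sup_{k ≤ n} [A_k + s_k + ⋯ + s_n]`, `n ∈ ℤ`, are finite. -/
def DeparturesFinite (A s : ℤ → ℝ) : Prop :=
  ∀ n : ℤ, BddAbove (Set.range fun k : Set.Iic n => partialLoad A s n k)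

/-- The departure time `D_n = sup_{k ≤ n} [A_k + s_k + ⋯ + s_n]` of customer `n`
(a genuine supremum when `DeparturesFinite A s` holds). -/
def departure (A s : ℤ → ℝ) (n : ℤ) : ℝ :=
  ⨆ k : Set.Iic n, partialLoad A s n k

/-- The time `r_n = min (D_n, A_{n+1}) - A_n` spent by customer `n` at the very back of the
queue. -/
def backTime (A s : ℤ → ℝ) (n : ℤ) : ℝ :=
  min (departure A s n) (A (n + 1)) - A n

/-- `(A_n, c_n)_n` is the enumeration, in increasing order, of a locally finite set of points of
the line, unbounded in both directions, with positive marks. -/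
structure IsMarkedPointSequence (A c : ℤ → ℝ) : Prop where
  strictMono : StrictMono A
  tendsto_atTop : Tendsto A atTop atTop
  tendsto_atBot : Tendsto A atBot atBot
  mark_pos : ∀ n, 0 < c n

/-- The counting measure `∑_n δ_{(A_n, c_n)}` of a marked point sequence. It does not depend on
the numbering of the points; the law of a marked point process is the law of this random
measure. -/
def markedCounting (A c : ℤ → ℝ) : Measure (ℝ × ℝ) :=
  Measure.sum fun n : ℤ => Measure.dirac (A n, c n)

variable {Ω : Type*} [MeasurableSpace Ω]

/-- `A = (A_n)_n` is the Bernoulli point process of parameter `p` on `ℤ`, numbered in increasing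
order so that `A_0 ≤ 0 < A_1`. -/
structure IsBernoulliPointProcess (P : Measure Ω) (p : ℝ) (A : ℤ → Ω → ℝ) : Prop where
  measurable : ∀ n, Measurable (A n)
  strictMono : ∀ᵐ ω ∂P, StrictMono fun n => A n ω
  numbering : ∀ᵐ ω ∂P, A 0 ω ≤ 0 ∧ 0 < A 1 ω
  integer_valued : ∀ᵐ ω ∂P, ∀ n, ∃ m : ℤ, A n ω = m
  prob_point : ∀ m : ℤ, P {ω | ∃ n, A n ω = m} = ENNReal.ofReal p
  indep : iIndepSet (fun m : ℤ => {ω | ∃ n, A n ω = m}) P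

/-- `s = (s_n)_n` is a sequence of i.i.d. random variables, geometric of parameter `q` on
`{1, 2, 3, …}`. -/
structure IsGeometricIID (P : Measure Ω) (q : ℝ) (s : ℤ → Ω → ℝ) : Prop where
  measurable : ∀ n, Measurable (s n)
  law : ∀ (n : ℤ) (k : ℕ), P {ω | s n ω = (k : ℝ) + 1} = ENNReal.ofReal ((1 - q) ^ k * q)
  indep : iIndepFun s P

end GeomQueue

end

/-!
The proof is a discrete form of Burke's theorem. Encode the input as a configuration: a sequence
`x : ℤ → ℕ` with `x t = 0` if nobody arrives at time `t`, and `x t = k` if a customer with service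
time `k ≥ 1` does. Under the hypotheses the `x t` are i.i.d. (`measure_config`). Encode the output
`(D_n, r_n)` in the same way as a configuration `y`; it has to be shown that `y` has the same law.

The state of the queue between departures and arrivals is the list of the customers present, each
with its remaining service and the time it has spent at the back of the queue. One time step maps
(state, input) to (state, output). This map is a bijection of a countable set, because it is
`serve` after the arrival phase, and the arrival phase is the time reversal of the inverse of
`serve` (`arrive`). Moreover it preserves the product of the weight `stateWeight` on the states and
the law of one input (`weight_step`). Hence a queue started with these weights has i.i.d. outputs
(`HasProductLaw.sweep`), and the total weight is finite because `p < q`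
(`tsum_stateWeight_ne_top`).

The stationary queue is reached from such queues started at time `-j` by letting `j` tend to
infinity. By the strong law of large numbers there are clearing times arbitrarily far in the past,
at which all earlier work is done, whatever happened before (`HasConfigLaw.ae_tendsto`,
`exists_isClearingTime`). From a clearing time on, the queue of the theorem is the one that starts
empty there (`sweep_eq_of_isClearingTime`), and so is, for `j` large, the queue started at `-j`
(`sweep_fst_eq_nil`). Therefore the outputs of the latter on a finite window converge to those of
the former, and `y` has the law of `x` (`HasConfigLaw.of_sweep`). The counting measures are
measurable functions of the configurations (`markedCounting_eq`, `measurable_configMeasure`).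
-/

noncomputable section

namespace GeomQueue

/-! ### One time step of the queue -/

/-- One unit of service. A state is the list of the customers present, in order of arrival; the
customer `(σ, ρ)` still needs `σ + 1` units of service and has spent `ρ + 1` time units at the
back of the queue (for the last customer this includes the unit being served). The second component
of `serve l` is `0` if nobody leaves, and otherwise the time (at least `1`) that the departing
customer has spent at the back. -/
def serve : List (ℕ × ℕ) → List (ℕ × ℕ) × ℕ
  | [] => ([], 0)
  | (0, r) :: l => (l, r + 1)
  | (s + 1, r) :: l => ((s, r) :: l, 0)

/-- The inverse of `serve`. -/
def unserve : List (ℕ × ℕ) × ℕ → List (ℕ × ℕ)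
  | ([], 0) => []
  | ((s, r) :: l, 0) => (s + 1, r) :: l
  | (l, r + 1) => (0, r) :: l

lemma unserve_serve (l : List (ℕ × ℕ)) : unserve (serve l) = l := by
  match l with
  | [] => rfl
  | (0, r) :: l => cases l <;> rfl
  | (s + 1, r) :: l => rfl

lemma serve_unserve (z : List (ℕ × ℕ) × ℕ) : serve (unserve z) = z := by
  match z with
  | ([], 0) => rfl
  | ((s, r) :: l, 0) => rfl
  | ([], r + 1) => rfl
  | (_ :: _, r + 1) => rfl

/-- Time reversal of a state: the customers are listed backwards, and remaining service is
exchanged with time spent at the back. -/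
def flipState (l : List (ℕ × ℕ)) : List (ℕ × ℕ) := (l.map Prod.swap).reverse

lemma flipState_flipState (l : List (ℕ × ℕ)) : flipState (flipState l) = l := by
  simp [flipState, List.map_reverse]

/-- The arrival phase: the input `k + 1` is a customer with service time `k + 1`, the input `0`
is no arrival, in which case the last customer spends one more time unit at the back. It is
defined as the time reversal of `unserve`, which exhibits the reversibility of the queue;
`arrive_concat` and `arrive_succ` give the explicit form. -/
def arrive (z : List (ℕ × ℕ) × ℕ) : List (ℕ × ℕ) := flipState (unserve (flipState z.1, z.2))

lemma arrive_concat (l : List (ℕ × ℕ)) (s r : ℕ) :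
    arrive (l ++ [(s, r)], 0) = l ++ [(s, r + 1)] := by
  have h : flipState (l ++ [(s, r)]) = (r, s) :: flipState l := by simp [flipState]
  have h' : flipState ((r + 1, s) :: flipState l) = flipState (flipState l) ++ [(s, r + 1)] := by
    simp [flipState]
  rw [arrive, h, unserve, h', flipState_flipState]

lemma arrive_succ (l : List (ℕ × ℕ)) (k : ℕ) : arrive (l, k + 1) = l ++ [(k, 0)] := by
  have h' : flipState ((0, k) :: flipState l) = flipState (flipState l) ++ [(k, 0)] := by
    simp [flipState]
  have hu : ∀ l, unserve (l, k + 1) = (0, k) :: l := fun l => by cases l <;> rfl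
  rw [arrive, hu, h', flipState_flipState]

/-- One time step: the arrival phase followed by one unit of service, as a bijection from pairs
(state, input) to pairs (new state, output). -/
def step : List (ℕ × ℕ) × ℕ ≃ List (ℕ × ℕ) × ℕ where
  toFun z := serve (arrive z)
  invFun z := (flipState (serve (flipState (unserve z))).1, (serve (flipState (unserve z))).2)
  left_inv z := by
    simp [unserve_serve, serve_unserve, flipState_flipState, arrive]
  right_inv z := by
    simp [unserve_serve, serve_unserve, flipState_flipState, arrive]

/-! ### The invariant weights -/

/-- The probability of seeing `k` at a given time in the input: `0` stands for no point, and
`k + 1` for a point with mark `k + 1`. -/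
def markWeight (p q : ℝ) : ℕ → ℝ
  | 0 => 1 - p
  | k + 1 => p * ((1 - q) ^ k * q)

/-- The factor contributed by a customer `(σ, ρ)` to the weight of a state: two geometric weights
and the load ratio `p (1 - q) / ((1 - p) q) < 1`. -/
def customerWeight (p q : ℝ) (c : ℕ × ℕ) : ℝ :=
  p * (1 - q) / ((1 - p) * q) * ((1 - q) ^ c.1 * q) * ((1 - q) ^ c.2 * q)

/-- The (unnormalized) stationary weight of a state taken after the departures and before the
arrivals of a time step. -/
def stateWeight (p q : ℝ) (l : List (ℕ × ℕ)) : ℝ := (l.map (customerWeight p q)).prod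

lemma stateWeight_flipState (p q : ℝ) (l : List (ℕ × ℕ)) :
    stateWeight p q (flipState l) = stateWeight p q l := by
  have h : customerWeight p q ∘ Prod.swap = customerWeight p q := by
    funext c; simp only [Function.comp, customerWeight, Prod.fst_swap, Prod.snd_swap]; ring
  rw [stateWeight, flipState, List.map_reverse, List.prod_reverse, List.map_map, h, stateWeight]

/-- The (unnormalized) stationary weight of a state taken after the arrivals of a time step and
before the unit of service. -/
def fullWeight (p q : ℝ) (l : List (ℕ × ℕ)) : ℝ :=
  stateWeight p q l * if l = [] then 1 - p else (1 - p) / (1 - q)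

/-- Service turns `fullWeight` into the product of `stateWeight` and the law of a mark. -/
lemma fullWeight_unserve {p q : ℝ} (hp : 0 < p) (hpq : p < q) (hq : q < 1)
    (z : List (ℕ × ℕ) × ℕ) :
    fullWeight p q (unserve z) = stateWeight p q z.1 * markWeight p q z.2 := by
  have h1 : 1 - q ≠ 0 := by linarith
  have h2 : 1 - p ≠ 0 := by linarith
  have h3 : q ≠ 0 := by linarith
  match z with
  | ([], 0) => simp [unserve, fullWeight, markWeight]
  | ((s, r) :: l, 0) =>
    simp only [unserve, fullWeight, markWeight, stateWeight, customerWeight, List.map_cons,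
      List.prod_cons, reduceCtorEq, if_false]
    field_simp
    ring
  | ([], r + 1) =>
    simp only [unserve, fullWeight, markWeight, stateWeight, customerWeight, List.map_cons,
      List.prod_cons, reduceCtorEq, if_false]
    field_simp
  | (_ :: _, r + 1) =>
    simp only [unserve, fullWeight, markWeight, stateWeight, customerWeight, List.map_cons,
      List.prod_cons, reduceCtorEq, if_false]
    field_simp

lemma fullWeight_flipState (p q : ℝ) (l : List (ℕ × ℕ)) :
    fullWeight p q (flipState l) = fullWeight p q l := by
  have : flipState l = [] ↔ l = [] := by simp [flipState]
  simp only [fullWeight, stateWeight_flipState, this]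

/-- The discrete form of Burke's theorem: the bijection `step` preserves the product of the
stationary weight of the state and the law of a mark. The arrival phase is the mirror image of
`fullWeight_unserve`. -/
lemma weight_step {p q : ℝ} (hp : 0 < p) (hpq : p < q) (hq : q < 1) (z : List (ℕ × ℕ) × ℕ) :
    stateWeight p q (step z).1 * markWeight p q (step z).2 =
      stateWeight p q z.1 * markWeight p q z.2 := by
  rw [← fullWeight_unserve hp hpq hq, step, Equiv.coe_fn_mk, unserve_serve, arrive,
    fullWeight_flipState, fullWeight_unserve hp hpq hq, stateWeight_flipState]

lemma markWeight_nonneg {p q : ℝ} (hp : 0 < p) (hpq : p < q) (hq : q < 1) (k : ℕ) :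
    0 ≤ markWeight p q k := by
  cases k with
  | zero => simp only [markWeight]; linarith
  | succ k =>
    have : 0 ≤ 1 - q := by linarith
    have : 0 < q := by linarith
    simp only [markWeight]; positivity

lemma customerWeight_nonneg {p q : ℝ} (hp : 0 < p) (hpq : p < q) (hq : q < 1) (c : ℕ × ℕ) :
    0 ≤ customerWeight p q c := by
  have : 0 ≤ 1 - q := by linarith
  have : 0 ≤ 1 - p := by linarith
  have : 0 < q := by linarith
  simp only [customerWeight]; positivity

lemma stateWeight_nonneg {p q : ℝ} (hp : 0 < p) (hpq : p < q) (hq : q < 1) (l : List (ℕ × ℕ)) :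
    0 ≤ stateWeight p q l := by
  refine List.prod_nonneg fun a ha => ?_
  obtain ⟨c, -, rfl⟩ := List.mem_map.1 ha
  exact customerWeight_nonneg hp hpq hq c

lemma hasSum_geometricWeight {q : ℝ} (hq0 : 0 < q) (hq : q < 1) :
    HasSum (fun k : ℕ => (1 - q) ^ k * q) 1 := by
  have h := (hasSum_geometric_of_lt_one (r := 1 - q) (by linarith) (by linarith)).mul_right q
  rwa [sub_sub_cancel, inv_mul_cancel₀ hq0.ne'] at h

lemma tsum_fin_prod {α : Type*} (f : α → ENNReal) (n : ℕ) :
    ∑' v : Fin n → α, ∏ i, f (v i) = (∑' a, f a) ^ n := by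
  induction n with
  | zero => simp
  | succ n ih =>
    rw [← (Fin.consEquiv fun _ : Fin (n + 1) => α).tsum_eq, ENNReal.tsum_prod', pow_succ']
    simp only [Fin.consEquiv, Equiv.coe_fn_mk, Fin.prod_univ_succ, Fin.cons_zero, Fin.cons_succ,
      ENNReal.tsum_mul_left, ih, ENNReal.tsum_mul_right]

lemma tsum_list_prod {α : Type*} (f : α → ENNReal) :
    ∑' l : List α, (l.map f).prod = ∑' n : ℕ, (∑' a, f a) ^ n := by
  rw [← List.equivSigmaTuple.symm.tsum_eq, ENNReal.tsum_sigma']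
  refine tsum_congr fun n => ?_
  rw [← tsum_fin_prod]
  refine tsum_congr fun v => ?_
  simp [List.equivSigmaTuple, List.prod_ofFn, List.map_ofFn]

lemma ofReal_stateWeight {p q : ℝ} (hp : 0 < p) (hpq : p < q) (hq : q < 1) (l : List (ℕ × ℕ)) :
    ENNReal.ofReal (stateWeight p q l) =
      (l.map fun c => ENNReal.ofReal (customerWeight p q c)).prod := by
  induction l with
  | nil => simp [stateWeight]
  | cons c l ih =>
    rw [List.map_cons, List.prod_cons, ← ih,
      ← ENNReal.ofReal_mul (customerWeight_nonneg hp hpq hq c)]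
    rfl

lemma tsum_stateWeight_ne_top {p q : ℝ} (hp : 0 < p) (hpq : p < q) (hq : q < 1) :
    ∑' l : List (ℕ × ℕ), ENNReal.ofReal (stateWeight p q l) ≠ ⊤ := by
  have hq0 : 0 < q := hp.trans hpq
  have h1 : 0 < 1 - p := by linarith
  have h2 : 0 < 1 - q := by linarith
  have hg : ∑' k : ℕ, ENNReal.ofReal ((1 - q) ^ k * q) = 1 := by
    rw [← ENNReal.ofReal_tsum_of_nonneg (fun k => by positivity)
      (hasSum_geometricWeight hq0 hq).summable, (hasSum_geometricWeight hq0 hq).tsum_eq,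
      ENNReal.ofReal_one]
  have hc : ∑' c : ℕ × ℕ, ENNReal.ofReal (customerWeight p q c) =
      ENNReal.ofReal (p * (1 - q) / ((1 - p) * q)) := by
    have : ∀ c, ENNReal.ofReal (customerWeight p q c) =
        ENNReal.ofReal (p * (1 - q) / ((1 - p) * q)) * ENNReal.ofReal ((1 - q) ^ c.1 * q) *
          ENNReal.ofReal ((1 - q) ^ c.2 * q) := fun c => by
      rw [customerWeight, ENNReal.ofReal_mul (by positivity), ENNReal.ofReal_mul (by positivity)]
    simp only [this]
    rw [ENNReal.tsum_prod']
    simp only [ENNReal.tsum_mul_left, hg, mul_one]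
  simp only [ofReal_stateWeight hp hpq hq]
  rw [tsum_list_prod, hc, ENNReal.tsum_geometric]
  refine ENNReal.inv_ne_top.2 (tsub_pos_of_lt ?_).ne'
  rw [← ENNReal.ofReal_one]
  refine (ENNReal.ofReal_lt_ofReal_iff one_pos).2 ?_
  rw [div_lt_one (by positivity)]
  nlinarith

lemma hasSum_markWeight {p q : ℝ} (hq0 : 0 < q) (hq : q < 1) : HasSum (markWeight p q) 1 := by
  rw [hasSum_nat_add_iff' 1 |>.symm]
  simpa [markWeight] using (hasSum_geometricWeight hq0 hq).mul_left p

/-! ### Running the queue over an interval of time -/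

instance : MeasurableSpace (List (ℕ × ℕ)) := ⊤

instance : DiscreteMeasurableSpace (List (ℕ × ℕ)) := ⟨fun _ => trivial⟩

/-- Performs the time step `t` on a pair (state, sequence), replacing the input at coordinate `t`
by the output. The state is taken just before the arrival at time `t`, so this output is the
departure at time `t + 1`. -/
def sweepAt (t : ℤ) (z : List (ℕ × ℕ) × (ℤ → ℕ)) : List (ℕ × ℕ) × (ℤ → ℕ) :=
  ((step (z.1, z.2 t)).1, Function.update z.2 t (step (z.1, z.2 t)).2)

/-- Performs the time steps `a, a + 1, …, a + n - 1`. -/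
def sweep (a : ℤ) : ℕ → List (ℕ × ℕ) × (ℤ → ℕ) → List (ℕ × ℕ) × (ℤ → ℕ)
  | 0, z => z
  | n + 1, z => sweepAt (a + n) (sweep a n z)

lemma measurable_sweepAt (t : ℤ) : Measurable (sweepAt t) := by
  have h : Measurable fun z : List (ℕ × ℕ) × (ℤ → ℕ) => step (z.1, z.2 t) :=
    (measurable_of_countable step).comp
      (measurable_fst.prodMk ((measurable_pi_apply t).comp measurable_snd))
  refine (measurable_fst.comp h).prodMk (measurable_pi_lambda _ fun u => ?_)
  by_cases hu : u = t
  · subst hu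
    simpa [Function.comp_def] using measurable_snd.comp h
  · have : Measurable fun z : List (ℕ × ℕ) × (ℤ → ℕ) => z.2 u :=
      (measurable_pi_apply u).comp measurable_snd
    simpa only [Function.update_of_ne hu] using this

lemma measurable_sweep (a : ℤ) (n : ℕ) : Measurable (sweep a n) := by
  induction n with
  | zero => exact measurable_id
  | succ n ih => exact (measurable_sweepAt _).comp ih

lemma sweep_add (a : ℤ) (m n : ℕ) (z : List (ℕ × ℕ) × (ℤ → ℕ)) :
    sweep a (m + n) z = sweep (a + m) n (sweep a m z) := by
  induction n with
  | zero => rfl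
  | succ n ih => rw [← add_assoc, sweep, sweep, ih]; push_cast; rw [add_assoc]

lemma sweep_snd_of_le (a : ℤ) (n : ℕ) (z : List (ℕ × ℕ) × (ℤ → ℕ)) (t : ℤ) (ht : a + n ≤ t) :
    (sweep a n z).2 t = z.2 t := by
  induction n with
  | zero => rfl
  | succ n ih =>
    push_cast at ht
    rw [← ih (by omega)]
    exact Function.update_of_ne (by omega) _ _

/-- Under the finite measure `Q`, the state has the stationary weights, and the sequence is an
independent i.i.d. sequence of marks. -/
def HasProductLaw {Ω : Type*} [MeasurableSpace Ω] (p q : ℝ) (Q : Measure Ω)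
    (Z : Ω → List (ℕ × ℕ) × (ℤ → ℕ)) : Prop :=
  ∀ (F : Finset ℤ) (l : List (ℕ × ℕ)) (b : ℤ → ℕ),
    Q {ω | (Z ω).1 = l ∧ ∀ t ∈ F, (Z ω).2 t = b t} =
      ENNReal.ofReal (stateWeight p q l) * ∏ t ∈ F, ENNReal.ofReal (markWeight p q (b t))

lemma measurableSet_forall_mem_eq {Ω : Type*} [MeasurableSpace Ω] {x : Ω → ℤ → ℕ}
    (hx : Measurable x) (F : Finset ℤ) (b : ℤ → ℕ) :
    MeasurableSet {ω | ∀ t ∈ F, x ω t = b t} := by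
  have : {ω | ∀ t ∈ F, x ω t = b t} = ⋂ t ∈ F, {ω | x ω t = b t} := by ext ω; simp
  rw [this]
  exact Finset.measurableSet_biInter _ fun t _ =>
    measurableSet_eq_fun ((measurable_pi_apply t).comp hx) measurable_const

lemma tsum_markWeight {p q : ℝ} (hp : 0 < p) (hpq : p < q) (hq : q < 1) :
    ∑' k, ENNReal.ofReal (markWeight p q k) = 1 := by
  have h := hasSum_markWeight (p := p) (hp.trans hpq) hq
  rw [← ENNReal.ofReal_tsum_of_nonneg (markWeight_nonneg hp hpq hq) h.summable, h.tsum_eq,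
    ENNReal.ofReal_one]

/-- A time step preserves the product law. On a cylinder which fixes coordinate `t`, this is
`weight_step`, because the preimage under a bijection of a single pair is a single pair; the
other cylinders are disjoint unions of such ones. -/
lemma HasProductLaw.sweepAt {Ω : Type*} [MeasurableSpace Ω] {p q : ℝ} (hp : 0 < p)
    (hpq : p < q) (hq : q < 1) {Q : Measure Ω} {Z : Ω → List (ℕ × ℕ) × (ℤ → ℕ)}
    (hm : Measurable Z) (hZ : HasProductLaw p q Q Z) (t : ℤ) :
    HasProductLaw p q Q fun ω => sweepAt t (Z ω) := by
  have key : ∀ (F : Finset ℤ) (l : List (ℕ × ℕ)) (b : ℤ → ℕ), t ∈ F →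
      Q {ω | (GeomQueue.sweepAt t (Z ω)).1 = l ∧ ∀ u ∈ F, (GeomQueue.sweepAt t (Z ω)).2 u = b u} =
      ENNReal.ofReal (stateWeight p q l) * ∏ u ∈ F, ENNReal.ofReal (markWeight p q (b u)) := by
    intro F l b ht
    obtain ⟨⟨l', k⟩, hk⟩ := step.surjective (l, b t)
    have hw := weight_step hp hpq hq (l', k)
    rw [hk] at hw
    have hset : {ω | (GeomQueue.sweepAt t (Z ω)).1 = l ∧
          ∀ u ∈ F, (GeomQueue.sweepAt t (Z ω)).2 u = b u} =
        {ω | (Z ω).1 = l' ∧ ∀ u ∈ F, (Z ω).2 u = Function.update b t k u} := by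
      ext ω
      simp only [Set.mem_ofPred_eq, GeomQueue.sweepAt]
      constructor
      · rintro ⟨h1, h2⟩
        have h3 := h2 t ht
        rw [Function.update_self] at h3
        have h4 : ((Z ω).1, (Z ω).2 t) = (l', k) := step.injective (by
          rw [hk]; exact Prod.ext h1 h3)
        refine ⟨congrArg Prod.fst h4, fun u hu => ?_⟩
        by_cases hut : u = t
        · subst hut; rw [Function.update_self]; exact congrArg Prod.snd h4
        · have := h2 u hu
          rw [Function.update_of_ne hut] at this ⊢
          exact this
      · rintro ⟨h1, h2⟩
        have h3 := h2 t ht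
        rw [Function.update_self] at h3
        rw [h1, h3, hk]
        refine ⟨rfl, fun u hu => ?_⟩
        by_cases hut : u = t
        · subst hut; rw [Function.update_self]
        · have := h2 u hu
          rw [Function.update_of_ne hut] at this ⊢
          exact this
    rw [hset, hZ, ← Finset.mul_prod_erase F _ ht, ← Finset.mul_prod_erase F _ ht, ← mul_assoc,
      ← mul_assoc, Function.update_self, ← ENNReal.ofReal_mul (stateWeight_nonneg hp hpq hq _),
      ← ENNReal.ofReal_mul (stateWeight_nonneg hp hpq hq _), hw]
    congr 1
    refine Finset.prod_congr rfl fun u hu => ?_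
    rw [Function.update_of_ne (Finset.ne_of_mem_erase hu)]
  intro F l b
  by_cases ht : t ∈ F
  · exact key F l b ht
  have hset : {ω | (GeomQueue.sweepAt t (Z ω)).1 = l ∧
        ∀ u ∈ F, (GeomQueue.sweepAt t (Z ω)).2 u = b u} =
      ⋃ c : ℕ, {ω | (GeomQueue.sweepAt t (Z ω)).1 = l ∧
        ∀ u ∈ insert t F, (GeomQueue.sweepAt t (Z ω)).2 u = Function.update b t c u} := by
    ext ω
    simp only [Set.mem_ofPred_eq, Set.mem_iUnion, Finset.forall_mem_insert, Function.update_self]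
    have hF : ∀ c, (∀ u ∈ F, (GeomQueue.sweepAt t (Z ω)).2 u = Function.update b t c u) ↔
        ∀ u ∈ F, (GeomQueue.sweepAt t (Z ω)).2 u = b u := fun c =>
      forall₂_congr fun u hu => by
        rw [Function.update_of_ne (fun h : u = t => ht (h ▸ hu))]
    simp only [hF]
    exact ⟨fun h => ⟨_, h.1, rfl, h.2⟩, fun ⟨c, h⟩ => ⟨h.1, h.2.2⟩⟩
  have hsm : Measurable fun ω => GeomQueue.sweepAt t (Z ω) := (measurable_sweepAt t).comp hm
  rw [hset, measure_iUnion]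
  · simp only [key _ _ _ (Finset.mem_insert_self t F), Finset.prod_insert ht,
      Function.update_self]
    have hF : ∀ c, ∏ u ∈ F, ENNReal.ofReal (markWeight p q (Function.update b t c u)) =
        ∏ u ∈ F, ENNReal.ofReal (markWeight p q (b u)) := fun c =>
      Finset.prod_congr rfl fun u hu => by
        rw [Function.update_of_ne (fun h : u = t => ht (h ▸ hu))]
    simp only [hF, ENNReal.tsum_mul_left, ENNReal.tsum_mul_right, tsum_markWeight hp hpq hq,
      one_mul]
  · intro c d hcd
    refine Set.disjoint_left.2 fun ω h1 h2 => hcd ?_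
    have e1 := h1.2 t (Finset.mem_insert_self t F)
    have e2 := h2.2 t (Finset.mem_insert_self t F)
    rw [Function.update_self] at e1 e2
    rw [← e1, ← e2]
  · intro c
    refine MeasurableSet.inter (measurableSet_eq_fun (measurable_fst.comp hsm) measurable_const) ?_
    exact measurableSet_forall_mem_eq (measurable_snd.comp hsm) _ _

lemma HasProductLaw.sweep {Ω : Type*} [MeasurableSpace Ω] {p q : ℝ} (hp : 0 < p)
    (hpq : p < q) (hq : q < 1) {Q : Measure Ω} {Z : Ω → List (ℕ × ℕ) × (ℤ → ℕ)}
    (hm : Measurable Z) (hZ : HasProductLaw p q Q Z) (a : ℤ) (n : ℕ) :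
    HasProductLaw p q Q fun ω => sweep a n (Z ω) := by
  induction n with
  | zero => exact hZ
  | succ n ih => exact ih.sweepAt hp hpq hq ((measurable_sweep a n).comp hm) _

lemma HasProductLaw.measure_snd {Ω : Type*} [MeasurableSpace Ω] {p q : ℝ} {Q : Measure Ω}
    {Z : Ω → List (ℕ × ℕ) × (ℤ → ℕ)} (hm : Measurable Z) (hZ : HasProductLaw p q Q Z)
    (F : Finset ℤ) (b : ℤ → ℕ) :
    Q {ω | ∀ t ∈ F, (Z ω).2 t = b t} =
      (∑' l, ENNReal.ofReal (stateWeight p q l)) *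
        ∏ t ∈ F, ENNReal.ofReal (markWeight p q (b t)) := by
  have hset : {ω | ∀ t ∈ F, (Z ω).2 t = b t} =
      ⋃ l, {ω | (Z ω).1 = l ∧ ∀ t ∈ F, (Z ω).2 t = b t} := by
    ext ω; simp
  rw [hset, measure_iUnion]
  · simp only [hZ F _ b, ENNReal.tsum_mul_right]
  · intro c d hcd
    exact Set.disjoint_left.2 fun ω h1 h2 => hcd (h1.1.symm.trans h2.1)
  · intro c
    refine MeasurableSet.inter (measurableSet_eq_fun (measurable_fst.comp hm) measurable_const) ?_
    exact measurableSet_forall_mem_eq (measurable_snd.comp hm) _ _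

/-! ### Load and clearing times -/

/-- The total remaining service in a state. -/
def load (l : List (ℕ × ℕ)) : ℕ := (l.map fun c => c.1 + 1).sum

lemma load_eq_zero {l : List (ℕ × ℕ)} : load l = 0 ↔ l = [] := by
  cases l <;> simp [load]

lemma load_arrive (l : List (ℕ × ℕ)) (x : ℕ) : load (arrive (l, x)) = load l + x := by
  cases x with
  | zero =>
    induction l using List.reverseRecOn with
    | nil => rfl
    | append_singleton l c _ => obtain ⟨s, r⟩ := c; rw [arrive_concat]; simp [load]
  | succ k => rw [arrive_succ]; simp [load]

lemma load_serve (l : List (ℕ × ℕ)) : load (serve l).1 = load l - 1 := by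
  match l with
  | [] => rfl
  | (0, r) :: l => simp [serve, load]
  | (s + 1, r) :: l => simp [serve, load]

lemma load_step (z : List (ℕ × ℕ) × ℕ) : load (step z).1 = load z.1 + z.2 - 1 := by
  rw [step, Equiv.coe_fn_mk, load_serve, load_arrive]

/-- At a clearing time `T`, the work that arrives during `[c, T)` never exceeds `T - c`, so that
all customers who arrive before `T` have left by `T`. -/
def IsClearingTime (x : ℤ → ℕ) (T : ℤ) : Prop :=
  ∀ c ≤ T, ∑ u ∈ Finset.Ico c T, ((x u : ℤ) - 1) ≤ 0

lemma sum_Ico_add_one {x : ℤ → ℤ} {a b : ℤ} (h : a ≤ b) :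
    ∑ u ∈ Finset.Ico a (b + 1), x u = ∑ u ∈ Finset.Ico a b, x u + x b := by
  have : Finset.Ico a (b + 1) = insert b (Finset.Ico a b) := by
    ext u; simp only [Finset.mem_Ico, Finset.mem_insert]; omega
  rw [this, Finset.sum_insert (by simp), add_comm]

lemma sum_Ico_add_sum_Ico {x : ℤ → ℤ} {a b c : ℤ} (hab : a ≤ b) (hbc : b ≤ c) :
    ∑ u ∈ Finset.Ico a b, x u + ∑ u ∈ Finset.Ico b c, x u = ∑ u ∈ Finset.Ico a c, x u := by
  rw [← Finset.Ico_union_Ico_eq_Ico hab hbc,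
    Finset.sum_union (Finset.Ico_disjoint_Ico_consecutive a b c)]

/-- Lindley's formula for the load, as an upper bound: either the server has always been busy, or
the load is at most what has been left over since the last time `c` when the queue was empty. -/
lemma load_sweep_le (a : ℤ) (n : ℕ) (z : List (ℕ × ℕ) × (ℤ → ℕ)) :
    (load (sweep a n z).1 : ℤ) ≤ load z.1 + ∑ u ∈ Finset.Ico a (a + n), ((z.2 u : ℤ) - 1) ∨
    ∃ c ≤ a + n, (load (sweep a n z).1 : ℤ) ≤ ∑ u ∈ Finset.Ico c (a + n), ((z.2 u : ℤ) - 1) := by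
  induction n with
  | zero => left; simp [sweep]
  | succ n ih =>
    have hx := sweep_snd_of_le a n z (a + n) le_rfl
    have hl : load (sweep a (n + 1) z).1 = load (sweep a n z).1 + z.2 (a + n) - 1 := by
      rw [sweep, sweepAt, load_step, hx]
    push_cast
    rw [← add_assoc]
    by_cases h0 : load (sweep a (n + 1) z).1 = 0
    · right; exact ⟨a + n + 1, le_rfl, by simp [h0]⟩
    rcases ih with h | ⟨c, hc, h⟩
    · left
      rw [sum_Ico_add_one (by omega)]; omega
    · right
      refine ⟨c, by omega, ?_⟩
      rw [sum_Ico_add_one hc]; omega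

lemma sweep_fst_eq_nil {x : ℤ → ℕ} {T : ℤ} (hT : IsClearingTime x T) (a : ℤ) (n : ℕ)
    (han : a + n = T) (l : List (ℕ × ℕ))
    (hl : load l + ∑ u ∈ Finset.Ico a T, ((x u : ℤ) - 1) ≤ 0) :
    (sweep a n (l, x)).1 = [] := by
  rw [← load_eq_zero]
  subst han
  rcases load_sweep_le a n (l, x) with h | ⟨c, hc, h⟩
  · simp only at h; omega
  · have := hT c hc
    simp only at h; omega

/-- If the walk drifts to `-∞` then clearing times exist arbitrarily far in the past: the times
at which the walk is maximal among all earlier times. -/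
lemma exists_isClearingTime {x : ℤ → ℕ}
    (hx : Tendsto (fun j : ℕ => ∑ u ∈ Finset.Ico (-(j : ℤ)) 0, ((x u : ℤ) - 1)) atTop atBot)
    (N : ℤ) : ∃ T ≤ N, IsClearingTime x T := by
  obtain ⟨i, hi⟩ := Filter.Tendsto.exists_forall_ge
    (f := fun i : ℕ => ∑ u ∈ Finset.Ico (-((i + N.natAbs : ℕ) : ℤ)) 0, ((x u : ℤ) - 1))
    (by rw [Nat.cofinite_eq_atTop]; exact hx.comp (tendsto_add_atTop_nat _))
  refine ⟨-((i + N.natAbs : ℕ) : ℤ), by omega, fun c hc => ?_⟩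
  have h := hi (c.natAbs - N.natAbs)
  have hc' : (-((c.natAbs - N.natAbs + N.natAbs : ℕ) : ℤ)) = c := by omega
  simp only [hc'] at h
  rw [← sum_Ico_add_sum_Ico hc (by omega)] at h
  omega

lemma eventually_sum_le {x : ℤ → ℕ}
    (hx : Tendsto (fun j : ℕ => ∑ u ∈ Finset.Ico (-(j : ℤ)) 0, ((x u : ℤ) - 1)) atTop atBot)
    {T : ℤ} (hT : T ≤ 0) (w : ℤ) :
    ∀ᶠ j : ℕ in atTop, w + ∑ u ∈ Finset.Ico (-(j : ℤ)) T, ((x u : ℤ) - 1) ≤ 0 := by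
  filter_upwards [hx.eventually_le_atBot (∑ u ∈ Finset.Ico T 0, ((x u : ℤ) - 1) - w),
    eventually_ge_atTop T.natAbs] with j hj hjT
  rw [← sum_Ico_add_sum_Ico (show -(j : ℤ) ≤ T by omega) hT] at hj
  omega

/-! ### Departure times -/

lemma add_sub_le_of_strictMono {B : ℤ → ℤ} (hB : StrictMono B) {m n : ℤ} (h : m ≤ n) :
    B m + (n - m) ≤ B n := by
  induction n, h using Int.leInduction with
  | base => omega
  | succ n _ ih => have := hB (show n < n + 1 by omega); omega

lemma exists_lt_iff_le {B : ℤ → ℤ} (hB : StrictMono B) (t : ℤ) : ∃ m, ∀ n, B n < t ↔ n ≤ m := by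
  obtain ⟨m, hm, hm'⟩ := Int.exists_greatest_of_bdd (P := fun n => B n < t)
    ⟨t - B 0 + t.natAbs + (B 0).natAbs, fun z hz => by
      by_contra h
      have := add_sub_le_of_strictMono hB (show 0 ≤ z by omega)
      omega⟩
    ⟨-(t - B 0).natAbs - 1, by
      have := add_sub_le_of_strictMono hB (show -((t - B 0).natAbs : ℤ) - 1 ≤ 0 by omega)
      omega⟩
  exact ⟨m, fun n => ⟨hm' n, fun h => (hB.monotone h).trans_lt hm⟩⟩

lemma Icc_add_one {k n : ℤ} (h : k ≤ n + 1) :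
    Finset.Icc k (n + 1) = insert (n + 1) (Finset.Icc k n) := by
  ext u; simp only [Finset.mem_Icc, Finset.mem_insert]; omega

lemma partialLoad_self (A s : ℤ → ℝ) (n : ℤ) : partialLoad A s n n = A n + s n := by
  simp [partialLoad]

lemma partialLoad_add_one (A s : ℤ → ℝ) {k n : ℤ} (h : k ≤ n) :
    partialLoad A s (n + 1) k = partialLoad A s n k + s (n + 1) := by
  rw [partialLoad, partialLoad, Icc_add_one (by omega), Finset.sum_insert (by simp)]
  ring

/-- Lindley's recursion for the departure times. -/
lemma departure_add_one {A s : ℤ → ℝ} (h : DeparturesFinite A s) (n : ℤ) :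
    departure A s (n + 1) = max (A (n + 1)) (departure A s n) + s (n + 1) := by
  have hne : ∀ n : ℤ, Nonempty (Set.Iic n) := fun n => ⟨⟨n, le_refl n⟩⟩
  have := hne n
  have := hne (n + 1)
  refine le_antisymm (ciSup_le ?_) ?_
  · rintro ⟨k, hk⟩
    rcases (show k ≤ n + 1 from hk).eq_or_lt with rfl | hk'
    · simp [partialLoad_self]
    · have hkn : k ≤ n := by omega
      simp only [partialLoad_add_one A s hkn]
      gcongr
      exact (le_ciSup (h n) (⟨k, hkn⟩ : Set.Iic n)).trans (le_max_right _ _)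
  · rw [← le_sub_iff_add_le]
    refine max_le ?_ (ciSup_le ?_)
    · rw [le_sub_iff_add_le, ← partialLoad_self]
      exact le_ciSup (h (n + 1)) (⟨n + 1, Set.self_mem_Iic⟩ : Set.Iic (n + 1))
    · rintro ⟨k, hk⟩
      have hkn : k ≤ n := hk
      rw [le_sub_iff_add_le, ← partialLoad_add_one A s hkn]
      exact le_ciSup (h (n + 1)) (⟨k, by simp only [Set.mem_Iic]; omega⟩ : Set.Iic (n + 1))

/-- Customers who arrive before a clearing time have left by then. -/
lemma partialLoad_le {B : ℤ → ℤ} {σ : ℤ → ℕ} {x : ℤ → ℕ} (hB : StrictMono B)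
    (hx : ∀ n, x (B n) = σ n + 1) {T : ℤ} (hT : IsClearingTime x T) {k n : ℤ} (hk : k ≤ n)
    (hn : B n < T) :
    partialLoad (fun n => (B n : ℝ)) (fun n => (σ n : ℝ) + 1) n k ≤ T := by
  have h1 : ∑ i ∈ Finset.Icc k n, ((σ i : ℤ) + 1) ≤ ∑ u ∈ Finset.Ico (B k) T, (x u : ℤ) := by
    have : ∑ i ∈ Finset.Icc k n, ((σ i : ℤ) + 1) =
        ∑ u ∈ (Finset.Icc k n).image B, (x u : ℤ) := by
      rw [Finset.sum_image hB.injective.injOn]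
      exact Finset.sum_congr rfl fun i _ => by rw [hx]; push_cast; ring
    rw [this]
    refine Finset.sum_le_sum_of_subset_of_nonneg ?_ fun _ _ _ => by positivity
    intro u hu
    obtain ⟨i, hi, rfl⟩ := Finset.mem_image.1 hu
    rw [Finset.mem_Icc] at hi
    exact Finset.mem_Ico.2 ⟨hB.monotone hi.1, (hB.monotone hi.2).trans_lt hn⟩
  have hBk : B k < T := (hB.monotone hk).trans_lt hn
  have h2 := hT (B k) hBk.le
  rw [Finset.sum_sub_distrib, Finset.sum_const, Int.card_Ico, nsmul_eq_mul, mul_one] at h2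
  have h3 : B k + ∑ i ∈ Finset.Icc k n, ((σ i : ℤ) + 1) ≤ T := by omega
  rw [partialLoad]
  exact_mod_cast h3

lemma departuresFinite {B : ℤ → ℤ} {σ : ℤ → ℕ} {x : ℤ → ℕ} (hB : StrictMono B)
    (hx : ∀ n, x (B n) = σ n + 1) (hT : ∀ N, ∃ T ≤ N, IsClearingTime x T) :
    DeparturesFinite (fun n => (B n : ℝ)) (fun n => (σ n : ℝ) + 1) := by
  intro n
  obtain ⟨T, hTn, hT⟩ := hT (B n)
  obtain ⟨m, hm⟩ := exists_lt_iff_le hB T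
  have hmn : m ≤ n := by
    by_contra h
    have := (hm n).2 (by omega)
    omega
  clear hTn
  induction n, hmn using Int.leInduction with
  | base =>
    refine ⟨T, ?_⟩
    rintro _ ⟨⟨k, hk⟩, rfl⟩
    exact partialLoad_le hB hx hT hk ((hm m).2 le_rfl)
  | succ n hn ih =>
    obtain ⟨C, hC⟩ := ih
    refine ⟨max (B (n + 1) : ℝ) C + (σ (n + 1) + 1), ?_⟩
    rintro _ ⟨⟨k, hk⟩, rfl⟩
    rcases (show k ≤ n + 1 from hk).eq_or_lt with rfl | hk'
    · simp [partialLoad_self]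
    · have hkn : k ≤ n := by omega
      simp only [partialLoad_add_one _ _ hkn]
      gcongr
      exact (hC ⟨⟨k, hkn⟩, rfl⟩).trans (le_max_right _ _)

/-- `E` satisfies the recursion of the departure times of the customers with arrival times `B n`
and service times `σ n + 1`, and the customers who arrive before a clearing time of the
configuration `x` have left by then. -/
structure IsIntegerDeparture (B : ℤ → ℤ) (σ : ℤ → ℕ) (x : ℤ → ℕ) (E : ℤ → ℤ) : Prop where
  recursion : ∀ n, E (n + 1) = max (B (n + 1)) (E n) + (σ (n + 1) + 1)
  le_clearing : ∀ T, IsClearingTime x T → ∀ n, B n < T → E n ≤ T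

/-- The departure times are integers: the first customer who arrives at or after a clearing time
is served at once, and the recursion does the rest. -/
lemma exists_isIntegerDeparture {B : ℤ → ℤ} {σ : ℤ → ℕ} {x : ℤ → ℕ} (hB : StrictMono B)
    (hx : ∀ n, x (B n) = σ n + 1) (hT : ∀ N, ∃ T ≤ N, IsClearingTime x T) :
    ∃ E, IsIntegerDeparture B σ x E ∧
      departure (fun n => (B n : ℝ)) (fun n => (σ n : ℝ) + 1) = fun n => (E n : ℝ) := by
  have hfin := departuresFinite hB hx hT
  have hrec := departure_add_one hfin
  set D := departure (fun n => (B n : ℝ)) (fun n => (σ n : ℝ) + 1) with hD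
  have hle : ∀ T, IsClearingTime x T → ∀ n, B n < T → D n ≤ T := fun T hT n hn => by
    have : Nonempty (Set.Iic n) := ⟨⟨n, le_refl n⟩⟩
    exact ciSup_le fun k => partialLoad_le hB hx hT k.2 hn
  have hint : ∀ n, ∃ e : ℤ, D n = e := by
    intro n
    obtain ⟨T, hTn, hT⟩ := hT (B n)
    obtain ⟨m, hm⟩ := exists_lt_iff_le hB T
    have hmn : m + 1 ≤ n := by
      by_contra h
      have := (hm n).2 (by omega)
      omega
    clear hTn
    induction n, hmn using Int.leInduction with
    | base =>
      have h1 : T ≤ B (m + 1) := not_lt.1 fun h => by have := (hm _).1 h; omega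
      refine ⟨B (m + 1) + (σ (m + 1) + 1), ?_⟩
      rw [hrec, max_eq_left ((hle T hT m ((hm m).2 le_rfl)).trans (by exact_mod_cast h1))]
      push_cast; ring
    | succ n hn ih =>
      obtain ⟨e, he⟩ := ih
      refine ⟨max (B (n + 1)) e + (σ (n + 1) + 1), ?_⟩
      rw [hrec, he]; push_cast; ring
  choose E hE using hint
  refine ⟨E, ⟨fun n => ?_, fun T hT n hn => ?_⟩, funext hE⟩
  · have := hrec n
    rw [hE, hE] at this
    exact_mod_cast this
  · have := hle T hT n hn
    rw [hE] at this
    exact_mod_cast this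

namespace IsIntegerDeparture

variable {B : ℤ → ℤ} {σ : ℤ → ℕ} {x : ℤ → ℕ} {E : ℤ → ℤ}

lemma strictMono (h : IsIntegerDeparture B σ x E) : StrictMono E :=
  strictMono_int_of_lt_succ fun n => by
    have := h.recursion n
    omega

lemma eq_max_add (h : IsIntegerDeparture B σ x E) (n : ℤ) :
    E n = max (B n) (E (n - 1)) + (σ n + 1) := by
  have := h.recursion (n - 1)
  rwa [sub_add_cancel] at this

end IsIntegerDeparture

/-! ### The queue as a list of customers -/

/-- The entry of customer `n` in the state: its remaining service at time `t` and its time at the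
back counted up to time `u`, both decreased by `1`. A customer who is not yet in service at time
`t` has its whole service time `E n - max (B n) (E (n - 1))` left. -/
def customer (B E : ℤ → ℤ) (t u n : ℤ) : ℕ × ℕ :=
  ((E n - max t (max (B n) (E (n - 1))) - 1).toNat, (min u (B (n + 1)) - B n - 1).toNat)

/-- The state in which the customers `h + 1, …, h + k` are present. -/
def queue (B E : ℤ → ℤ) (t u h : ℤ) (k : ℕ) : List (ℕ × ℕ) :=
  (List.range k).map fun i : ℕ => customer B E t u (h + 1 + i)

lemma queue_congr {B E : ℤ → ℤ} {t u t' u' h : ℤ} {k : ℕ}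
    (H : ∀ n, h < n → n ≤ h + k → customer B E t u n = customer B E t' u' n) :
    queue B E t u h k = queue B E t' u' h k :=
  List.map_congr_left fun i hi => H _ (by omega) (by have := List.mem_range.1 hi; omega)

lemma queue_succ_last (B E : ℤ → ℤ) (t u h : ℤ) (k : ℕ) :
    queue B E t u h (k + 1) = queue B E t u h k ++ [customer B E t u (h + k + 1)] := by
  rw [queue, List.range_succ, List.map_append, List.map_singleton, queue, add_right_comm]

lemma queue_succ_first (B E : ℤ → ℤ) (t u h : ℤ) (k : ℕ) :
    queue B E t u h (k + 1) = customer B E t u (h + 1) :: queue B E t u (h + 1) k := by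
  rw [queue, List.range_succ_eq_map, List.map_cons, List.map_map, queue]
  congr 1
  · congr 1; omega
  · refine List.map_congr_left fun i _ => ?_
    simp only [Function.comp]
    congr 1; push_cast; omega

/-- The arrival phase at time `t` only moves the time up to which the time at the back is counted
from `t` to `t + 1`, and adds the customer arriving at time `t`, if any. -/
lemma arrive_queue {B : ℤ → ℤ} {σ x : ℤ → ℕ} {E : ℤ → ℤ} (hB : StrictMono B)
    (hx : ∀ n, x (B n) = σ n + 1) (hx0 : ∀ t, (∀ n, B n ≠ t) → x t = 0)
    (hE : IsIntegerDeparture B σ x E) {t h : ℤ} {k : ℕ} (hk : ∀ n, B n < t ↔ n ≤ h + k) :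
    ∃ k' : ℕ, (∀ n, B n < t + 1 ↔ n ≤ h + k') ∧
      arrive (queue B E t t h k, x t) = queue B E t (t + 1) h k' := by
  have hlt : ∀ n, n < h + k → B (n + 1) < t := fun n hn => (hk _).2 (by omega)
  have hge : t ≤ B (h + k + 1) := not_lt.1 fun hlt => by have := (hk _).1 hlt; omega
  by_cases ht : B (h + k + 1) = t
  · refine ⟨k + 1, fun n => ?_, ?_⟩
    · have := hB.lt_iff_lt (a := h + k + 1) (b := n)
      have := hk n
      omega
    · have hxt := hx (h + k + 1)
      rw [ht] at hxt
      rw [hxt, arrive_succ, queue_succ_last]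
      have h1 : queue B E t t h k = queue B E t (t + 1) h k := queue_congr fun n _ hn => by
        rcases hn.lt_or_eq with hn | rfl
        · have := hlt n hn
          simp only [customer]
          congr 2; omega
        · simp only [customer, ht]
          congr 2; omega
      rw [h1]
      congr 2
      have h2 := hE.eq_max_add (h + k + 1)
      have h3 := hB (show h + k + 1 < h + k + 1 + 1 by omega)
      rw [ht] at h2 h3
      simp only [customer, ht]
      ext <;> simp only <;> omega
  · have hk' : ∀ n, B n < t + 1 ↔ n ≤ h + k := fun n => by
      rw [← hk n]
      have := hB.lt_iff_lt (a := h + k + 1) (b := n)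
      have := hk n
      by_cases hn : n = h + k + 1
      · subst hn; omega
      · omega
    refine ⟨k, hk', ?_⟩
    have hxt : x t = 0 := hx0 t fun n hn => by
      have h1 := hk n
      have h2 := hk' n
      omega
    rw [hxt]
    cases k with
    | zero => rfl
    | succ k =>
      rw [queue_succ_last, queue_succ_last]
      have h0 : B (h + k + 1) < t := (hk _).2 (by push_cast; omega)
      have h1 : queue B E t t h k = queue B E t (t + 1) h k := queue_congr fun n _ hn => by
        have := hlt n (by push_cast; omega)
        simp only [customer]
        congr 2; omega
      rw [h1, customer, arrive_concat, customer]
      congr 3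
      push_cast at hge ht
      rw [← add_assoc] at hge ht
      omega

/-- The unit of service during `[t, t + 1]` leads to the queue at time `t + 1`, and its output is
the time at the back of the customer who leaves at time `t + 1`, if any. -/
lemma serve_queue {B : ℤ → ℤ} {σ x : ℤ → ℕ} {E : ℤ → ℤ} (hB : StrictMono B)
    (hE : IsIntegerDeparture B σ x E) {t h : ℤ} {k : ℕ} (hk : ∀ n, B n < t + 1 ↔ n ≤ h + k)
    (hh : ∀ n, E n ≤ t ↔ n ≤ h) :
    ∃ (h' : ℤ) (k' : ℕ), (∀ n, B n < t + 1 ↔ n ≤ h' + k') ∧ (∀ n, E n ≤ t + 1 ↔ n ≤ h') ∧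
      (serve (queue B E t (t + 1) h k)).1 = queue B E (t + 1) (t + 1) h' k' ∧
      (∀ n, E n = t + 1 →
        ((serve (queue B E t (t + 1) h k)).2 : ℤ) = min (E n) (B (n + 1)) - B n) ∧
      ((∀ n, E n ≠ t + 1) → (serve (queue B E t (t + 1) h k)).2 = 0) := by
  have hEm := hE.strictMono
  have h1 := (hh h).2 le_rfl
  have h2 : t < E (h + 1) := not_le.1 fun hlt => by have := (hh _).1 hlt; omega
  have hle : E (h + 1) ≠ t + 1 → ∀ n, E n ≤ t + 1 ↔ n ≤ h := fun hne n => by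
    have := hh n
    have := hEm.le_iff_le (a := h + 1) (b := n)
    omega
  have hrec := hE.recursion h
  cases k with
  | zero =>
    have h3 : t < B (h + 1) := by
      have := hk (h + 1)
      push_cast at this; omega
    have hle := hle (by omega)
    refine ⟨h, 0, hk, hle, rfl, fun n hn => ?_, fun _ => rfl⟩
    have := hh n
    have := hle n
    omega
  | succ k =>
    have h3 : B (h + 1) < t + 1 := (hk _).2 (by push_cast; omega)
    rw [queue_succ_first, customer, add_sub_cancel_right]
    have hcongr : ∀ n, h + 1 < n → customer B E t (t + 1) n = customer B E (t + 1) (t + 1) n :=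
      fun n hn => by
        have := hEm.monotone (show h + 1 ≤ n - 1 by omega)
        simp only [customer]
        congr 2; omega
    by_cases hd : E (h + 1) = t + 1
    · have h4 : (E (h + 1) - max t (max (B (h + 1)) (E h)) - 1).toNat = 0 := by omega
      rw [h4, serve]
      refine ⟨h + 1, k, fun n => ?_, fun n => ?_, queue_congr fun n hn _ => hcongr n hn,
        fun n hn => ?_, fun hn => (hn _ hd).elim⟩
      · have := hk n; push_cast at this; omega
      · rw [← hd, hEm.le_iff_le]
      · have : n = h + 1 := hEm.injective (hn.trans hd.symm)
        subst this
        have := hB (show h + 1 < h + 1 + 1 by omega)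
        simp only
        omega
    · obtain ⟨j, hj⟩ : ∃ j, (E (h + 1) - max t (max (B (h + 1)) (E h)) - 1).toNat = j + 1 :=
        ⟨_, (Nat.succ_pred_eq_of_ne_zero (by omega)).symm⟩
      have hle := hle hd
      rw [hj, serve]
      refine ⟨h, k + 1, hk, hle, ?_, fun n hn => ?_, fun _ => rfl⟩
      · simp only
        rw [queue_succ_first, queue_congr fun n hn _ => hcongr n hn, customer,
          add_sub_cancel_right]
        congr 2; omega
      · have := hh n
        have := hle n
        omega

/-- Started with the empty state at a clearing time, the queue outputs the configuration `y` of
the points `E n` with marks `min (E n) (B (n + 1)) - B n`. -/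
lemma sweep_eq_of_isClearingTime {B : ℤ → ℤ} {σ x : ℤ → ℕ} {E : ℤ → ℤ} (hB : StrictMono B)
    (hx : ∀ n, x (B n) = σ n + 1) (hx0 : ∀ t, (∀ n, B n ≠ t) → x t = 0)
    (hE : IsIntegerDeparture B σ x E) {T : ℤ} (hT : IsClearingTime x T)
    {y : ℤ → ℕ} (hy : ∀ n, (y (E n) : ℤ) = min (E n) (B (n + 1)) - B n)
    (hy0 : ∀ t, (∀ n, E n ≠ t) → y t = 0)
    {z : List (ℕ × ℕ) × (ℤ → ℕ)} (hz : z.1 = []) (hzx : ∀ t, T ≤ t → z.2 t = x t) (i : ℕ) :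
    ∀ t, T ≤ t → t < T + i → (sweep T i z).2 t = y (t + 1) := by
  suffices H : (∃ (h : ℤ) (k : ℕ), (∀ n, B n < T + i ↔ n ≤ h + k) ∧
      (∀ n, E n ≤ T + i ↔ n ≤ h) ∧ (sweep T i z).1 = queue B E (T + i) (T + i) h k) ∧
      ∀ t, T ≤ t → t < T + i → (sweep T i z).2 t = y (t + 1) from H.2
  induction i with
  | zero =>
    obtain ⟨h, hh⟩ := exists_lt_iff_le hB T
    refine ⟨⟨h, 0, by simpa using hh, fun n => ?_, hz⟩,
      fun t h1 h2 => by push_cast at h2; omega⟩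
    have h1 := hE.le_clearing T hT n
    have h2 := hE.eq_max_add n
    have := hh n
    push_cast
    by_cases hn : n ≤ h
    · omega
    · omega
  | succ i ih =>
    obtain ⟨⟨h, k, hk, hh, hl⟩, hold⟩ := ih
    obtain ⟨k', hk', harr⟩ := arrive_queue hB hx hx0 hE hk
    obtain ⟨h2, k2, hk2, hh2, hserve, hout, hout0⟩ := serve_queue hB hE hk' hh
    have hxt : (sweep T i z).2 (T + i) = x (T + i) := by
      rw [sweep_snd_of_le T i z _ le_rfl, hzx _ (by omega)]
    have hstep : step ((sweep T i z).1, (sweep T i z).2 (T + i)) =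
        serve (queue B E (T + i) (T + i + 1) h k') := by
      rw [hl, hxt, ← harr]; rfl
    push_cast
    rw [← add_assoc]
    refine ⟨⟨h2, k2, hk2, hh2, ?_⟩, fun t ht1 ht2 => ?_⟩
    · rw [sweep, sweepAt, hstep]; exact hserve
    · rw [sweep, sweepAt, hstep]
      simp only
      by_cases htT : t = T + i
      · subst htT
        rw [Function.update_self]
        by_cases hn : ∃ n, E n = T + i + 1
        · obtain ⟨n, hn⟩ := hn
          have h3 := hout n hn
          have h4 := hy n
          rw [hn] at h3 h4
          omega
        · push Not at hn
          rw [hout0 hn, hy0 _ hn]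
      · rw [Function.update_of_ne htT]
        exact hold t ht1 (by omega)

/-! ### The configuration of a marked point sequence -/

/-- The configuration on `ℤ` of the points `A n` with marks `c n`: its value at `t` is the mark of
the point at `t`, and `0` if there is none (for distinct points and marks in `{1, 2, …}`). The sum,
which has at most one nonzero term, makes the definition measurable without any choice. -/
@[irreducible] def config (A c : ℤ → ℝ) (t : ℤ) : ℕ :=
  ⌊(∑' n, ENNReal.ofReal (if A n = t then c n else 0)).toReal⌋₊

lemma config_apply {A c : ℤ → ℝ} (hA : Function.Injective A) {n t : ℤ} (ht : A n = t) {k : ℕ}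
    (hk : c n = k) : config A c t = k := by
  rw [config, tsum_eq_single n, if_pos ht, hk, ENNReal.ofReal_natCast, ENNReal.toReal_natCast,
    Nat.floor_natCast]
  intro m hm
  rw [if_neg fun h => hm (hA (h.trans ht.symm)), ENNReal.ofReal_zero]

lemma config_of_ne {A c : ℤ → ℝ} {t : ℤ} (h : ∀ n, A n ≠ t) : config A c t = 0 := by
  simp [config, h]

lemma measurable_config : Measurable fun z : (ℤ → ℝ) × (ℤ → ℝ) => config z.1 z.2 := by
  unfold config
  refine measurable_pi_lambda _ fun t => Nat.measurable_floor.comp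
    (ENNReal.measurable_toReal.comp (Measurable.tsum fun n =>
      ENNReal.measurable_ofReal.comp (Measurable.ite ?_ ?_ measurable_const)))
  · exact measurableSet_eq_fun ((measurable_pi_apply n).comp measurable_fst) measurable_const
  · exact (measurable_pi_apply n).comp measurable_snd

lemma measurable_config_comp {Ω : Type*} [MeasurableSpace Ω] {A c : Ω → ℤ → ℝ}
    (hA : ∀ n, Measurable fun ω => A ω n) (hc : ∀ n, Measurable fun ω => c ω n) :
    Measurable fun ω => config (A ω) (c ω) :=
  measurable_config.comp ((measurable_pi_lambda A hA).prodMk (measurable_pi_lambda c hc))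

section InputLaw

variable {Ω : Type*} [MeasurableSpace Ω] {P : Measure Ω} [IsProbabilityMeasure P] {p q : ℝ}
  {A s : ℤ → Ω → ℝ}

lemma IsBernoulliPointProcess.ae_exists_int {Ω : Type*} [MeasurableSpace Ω] {P : Measure Ω}
    {p : ℝ} {A : ℤ → Ω → ℝ} (hA : IsBernoulliPointProcess P p A) :
    ∀ᵐ ω ∂P, ∃ B : ℤ → ℤ, StrictMono B ∧ (fun n => A n ω) = fun n => (B n : ℝ) := by
  filter_upwards [hA.strictMono, hA.integer_valued] with ω h1 h2
  choose B hB using h2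
  refine ⟨B, fun m n hmn => ?_, funext hB⟩
  have := h1 hmn
  simp only [hB] at this
  exact_mod_cast this

lemma IsGeometricIID.ae_exists_nat (hq0 : 0 < q) (hq : q < 1) (hs : IsGeometricIID P q s) :
    ∀ᵐ ω ∂P, ∃ σ : ℤ → ℕ, (fun n => s n ω) = fun n => (σ n : ℝ) + 1 := by
  have h : ∀ n, ∀ᵐ ω ∂P, ∃ k : ℕ, s n ω = (k : ℝ) + 1 := by
    intro n
    have hset : {ω | ∃ k : ℕ, s n ω = (k : ℝ) + 1} = ⋃ k : ℕ, {ω | s n ω = (k : ℝ) + 1} := by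
      ext ω; simp
    have hm : ∀ k : ℕ, MeasurableSet {ω | s n ω = (k : ℝ) + 1} := fun k =>
      measurableSet_eq_fun (hs.measurable n) measurable_const
    have h1 : 0 ≤ 1 - q := by linarith
    have hsum := hasSum_geometricWeight hq0 hq
    rw [ae_iff_prob_eq_one (by
      change Measurable fun ω => ω ∈ {ω | ∃ k : ℕ, s n ω = (k : ℝ) + 1}
      rw [hset]
      exact measurable_mem.2 (MeasurableSet.iUnion hm)), hset, measure_iUnion ?_ hm]
    · simp only [hs.law]
      rw [← ENNReal.ofReal_tsum_of_nonneg (fun k => by positivity) hsum.summable, hsum.tsum_eq,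
        ENNReal.ofReal_one]
    · intro j k hjk
      refine Set.disjoint_left.2 fun ω h1 h2 => hjk ?_
      have h3 : (j : ℝ) + 1 = k + 1 := h1.symm.trans h2
      exact_mod_cast add_right_cancel h3
  filter_upwards [ae_all_iff.2 h] with ω hω
  choose σ hσ using hω
  exact ⟨σ, funext hσ⟩

/-- The probability that the points within `F` are exactly those `t` with `b t ≠ 0`. -/
lemma measure_pattern (hp : 0 < p) (hA : IsBernoulliPointProcess P p A)
    (F : Finset ℤ) (b : ℤ → ℕ) :
    P {ω | ∀ t ∈ F, (∃ n, A n ω = t) ↔ b t ≠ 0} =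
      ∏ t ∈ F, ENNReal.ofReal (if b t = 0 then 1 - p else p) := by
  classical
  set S : ℤ → Set Ω := fun t => {ω | ∃ n, A n ω = t} with hS
  have hSm : ∀ t, MeasurableSet (S t) := fun t => by
    have : S t = ⋃ n, {ω | A n ω = t} := by ext ω; simp [hS]
    rw [this]
    exact MeasurableSet.iUnion fun n => measurableSet_eq_fun (hA.measurable n) measurable_const
  have hset : {ω | ∀ t ∈ F, (∃ n, A n ω = t) ↔ b t ≠ 0} =
      ⋂ t ∈ F, if b t = 0 then (S t)ᶜ else S t := by
    ext ω
    simp only [Set.mem_ofPred_eq, Set.mem_iInter]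
    refine forall₂_congr fun t _ => ?_
    split_ifs with h <;> simp [h, hS]
  have hind : iIndep (fun t => MeasurableSpace.generateFrom {S t}) P := hA.indep
  rw [hset, hind.meas_biInter fun t _ => ?_]
  · refine Finset.prod_congr rfl fun t _ => ?_
    have hP : P (S t) = ENNReal.ofReal p := hA.prob_point t
    split_ifs
    · rw [prob_compl_eq_one_sub (hSm t), hP, ENNReal.ofReal_sub _ hp.le, ENNReal.ofReal_one]
    · exact hP
  · have h : MeasurableSet[MeasurableSpace.generateFrom {S t}] (S t) :=
      MeasurableSpace.measurableSet_generateFrom rfl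
    split_ifs
    · exact h.compl
    · exact h

/-- The law of the configuration when the points are fixed: distinct points carry distinct, hence
independent, marks. -/
lemma measure_config_fixed (hq0 : 0 < q) (hq : q < 1) (hs : IsGeometricIID P q s) {a : ℤ → ℝ}
    (ha : Function.Injective a) (F : Finset ℤ) (b : ℤ → ℕ) :
    P {ω | ∀ t ∈ F, config a (fun n => s n ω) t = b t} =
      {a : ℤ → ℝ | ∀ t ∈ F, (∃ n, a n = t) ↔ b t ≠ 0}.indicator
        (fun _ => ∏ t ∈ F, ENNReal.ofReal (if b t = 0 then 1 else (1 - q) ^ (b t - 1) * q)) a := by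
  classical
  have hae := hs.ae_exists_nat hq0 hq
  by_cases hG : ∀ t ∈ F, (∃ n, a n = t) ↔ b t ≠ 0
  · rw [Set.indicator_of_mem (by exact hG)]
    -- The points of `F`, and the index `N t` of the customer arriving at `t`.
    set F' := F.filter fun t => b t ≠ 0 with hF'
    have hN : ∀ t : F', ∃ n, a n = (t : ℤ) := fun t =>
      (hG t (Finset.mem_filter.1 t.2).1).2 (Finset.mem_filter.1 t.2).2
    choose N hN using hN
    have hNinj : Function.Injective N := fun t u h => by
      have h1 := hN t
      rw [h, hN u] at h1
      exact Subtype.ext (by exact_mod_cast h1.symm)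
    have hind : iIndepFun (fun t : F' => s (N t)) P := hs.indep.precomp hNinj
    have hcongr : P {ω | ∀ t ∈ F, config a (fun n => s n ω) t = b t} =
        P (⋂ t ∈ (Finset.univ : Finset F'), s (N t) ⁻¹' {(b t : ℝ)}) := by
      refine measure_congr ?_
      filter_upwards [hae] with ω ⟨σ, hσ⟩
      refine propext ?_
      change (∀ t ∈ F, config a (fun n => s n ω) t = b t) ↔ ω ∈ (⋂ t ∈ _, _)
      have hσ' : ∀ n, s n ω = ((σ n + 1 : ℕ) : ℝ) := fun n => by
        rw [congrFun hσ n]; push_cast; rfl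
      have hval : ∀ t : F', config a (fun n => s n ω) t = b t ↔ s (N t) ω = b t := fun t => by
        rw [config_apply ha (hN t) (hσ' (N t)), hσ']
        exact_mod_cast Iff.rfl
      simp only [Set.mem_iInter, Finset.mem_univ, true_imp_iff, Set.mem_preimage,
        Set.mem_singleton_iff, ← hval]
      constructor
      · exact fun h t => h t (Finset.mem_filter.1 t.2).1
      · intro h t ht
        by_cases hb : b t = 0
        · rw [hb]
          refine config_of_ne fun n hn => ?_
          exact (hG t ht).1 ⟨n, hn⟩ hb
        · exact h ⟨t, Finset.mem_filter.2 ⟨ht, hb⟩⟩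
    rw [hcongr, hind.measure_inter_preimage_eq_mul Finset.univ (sets := fun t => {(b t : ℝ)})
      fun t _ => measurableSet_singleton _]
    have hval : ∀ t : F', P (s (N t) ⁻¹' {(b t : ℝ)}) =
        ENNReal.ofReal ((1 - q) ^ (b t - 1) * q) := fun t => by
      have hb : b t ≠ 0 := (Finset.mem_filter.1 t.2).2
      rw [← hs.law (N t) (b t - 1)]
      congr 1
      ext ω
      simp only [Set.mem_preimage, Set.mem_singleton_iff, Set.mem_ofPred_eq]
      rw [← Nat.cast_add_one, Nat.sub_add_cancel (Nat.pos_of_ne_zero hb)]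
    simp only [hval]
    rw [Finset.prod_coe_sort F' fun t => ENNReal.ofReal ((1 - q) ^ (b t - 1) * q), hF',
      Finset.prod_filter]
    refine Finset.prod_congr rfl fun t _ => ?_
    by_cases hb : b t = 0 <;> simp [hb]
  · rw [Set.indicator_of_notMem (by exact hG)]
    have h0 : ∀ᵐ ω ∂P, ¬ ∀ t ∈ F, config a (fun n => s n ω) t = b t := by
      filter_upwards [hae] with ω ⟨σ, hσ⟩ h
      refine hG fun t ht => ⟨fun ⟨n, hn⟩ hb => ?_, fun hb => ?_⟩
      · have h1 := h t ht
        rw [config_apply ha hn (k := σ n + 1) (by rw [congrFun hσ n]; push_cast; rfl), hb] at h1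
        omega
      · by_contra hne
        push Not at hne
        exact hb ((h t ht).symm.trans (config_of_ne hne))
    simpa [ae_iff] using h0

/-- The configuration of the input is i.i.d.; by independence, the points may be fixed first. -/
lemma measure_config (hp : 0 < p) (hpq : p < q) (hq : q < 1)
    (hA : IsBernoulliPointProcess P p A) (hs : IsGeometricIID P q s)
    (hAs : IndepFun (fun ω n => A n ω) (fun ω n => s n ω) P) (F : Finset ℤ) (b : ℤ → ℕ) :
    P {ω | ∀ t ∈ F, config (fun n => A n ω) (fun n => s n ω) t = b t} =
      ∏ t ∈ F, ENNReal.ofReal (markWeight p q (b t)) := by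
  have hq0 := hp.trans hpq
  have hAm : Measurable fun ω n => A n ω := measurable_pi_lambda _ hA.measurable
  have hsm : Measurable fun ω n => s n ω := measurable_pi_lambda _ hs.measurable
  have hS := measurableSet_forall_mem_eq measurable_config F b
  have hmap := (indepFun_iff_map_prod_eq_prod_map_map hAm.aemeasurable hsm.aemeasurable).1 hAs
  have h1 : P {ω | ∀ t ∈ F, config (fun n => A n ω) (fun n => s n ω) t = b t} =
      (P.map fun ω => ((fun n => A n ω), (fun n => s n ω)))
        {z | ∀ t ∈ F, config z.1 z.2 t = b t} := by
    rw [Measure.map_apply (hAm.prodMk hsm) hS]; rfl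
  have : IsProbabilityMeasure (P.map fun ω n => s n ω) :=
    Measure.isProbabilityMeasure_map hsm.aemeasurable
  rw [h1, hmap, Measure.prod_apply hS, lintegral_map (measurable_measure_prodMk_left hS) hAm]
  have h2 : ∀ᵐ ω ∂P, (P.map fun ω n => s n ω) (Prod.mk (fun n => A n ω) ⁻¹'
      {z | ∀ t ∈ F, config z.1 z.2 t = b t}) =
      {ω | ∀ t ∈ F, (∃ n, A n ω = t) ↔ b t ≠ 0}.indicator
        (fun _ => ∏ t ∈ F, ENNReal.ofReal (if b t = 0 then 1 else (1 - q) ^ (b t - 1) * q)) ω := by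
    filter_upwards [hA.strictMono] with ω hω
    rw [Measure.map_apply hsm (measurable_prodMk_left hS)]
    exact measure_config_fixed hq0 hq hs hω.injective F b
  have hm : MeasurableSet {ω | ∀ t ∈ F, (∃ n, A n ω = t) ↔ b t ≠ 0} := by
    have : {ω | ∀ t ∈ F, (∃ n, A n ω = t) ↔ b t ≠ 0} =
        ⋂ t ∈ F, {ω | (∃ n, A n ω = t) ↔ b t ≠ 0} := by ext ω; simp
    rw [this]
    refine Finset.measurableSet_biInter _ fun t _ => ?_
    have hSt : MeasurableSet {ω | ∃ n, A n ω = t} := by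
      have : {ω | ∃ n, A n ω = t} = ⋃ n, {ω | A n ω = t} := by ext ω; simp
      rw [this]
      exact MeasurableSet.iUnion fun n => measurableSet_eq_fun (hA.measurable n) measurable_const
    by_cases hb : b t = 0
    · convert hSt.compl using 1
      ext ω; simp [hb]
    · convert hSt using 1
      ext ω; simp [hb]
  rw [lintegral_congr_ae h2, lintegral_indicator hm, setLIntegral_const,
    measure_pattern hp hA, mul_comm, ← Finset.prod_mul_distrib]
  refine Finset.prod_congr rfl fun t _ => ?_
  cases b t with
  | zero => simp [markWeight]
  | succ k =>
    simp only [markWeight, Nat.add_eq_zero_iff, one_ne_zero, and_false, if_false,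
      Nat.add_sub_cancel]
    rw [ENNReal.ofReal_mul hp.le]

end InputLaw

/-! ### I.i.d. configurations -/

/-- Under `P`, the sequence `x` is i.i.d. with the law `markWeight p q`. -/
def HasConfigLaw {Ω : Type*} [MeasurableSpace Ω] (p q : ℝ) (P : Measure Ω) (x : Ω → ℤ → ℕ) :
    Prop :=
  ∀ (F : Finset ℤ) (b : ℤ → ℕ),
    P {ω | ∀ t ∈ F, x ω t = b t} = ∏ t ∈ F, ENNReal.ofReal (markWeight p q (b t))

lemma HasConfigLaw.measure_eq {Ω : Type*} [MeasurableSpace Ω] {P : Measure Ω} {p q : ℝ}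
    {x : Ω → ℤ → ℕ} (hx : HasConfigLaw p q P x) (t : ℤ) (k : ℕ) :
    P {ω | x ω t = k} = ENNReal.ofReal (markWeight p q k) := by
  simpa using hx {t} fun _ => k

section FiniteDimensional

variable {Ω : Type*} [MeasurableSpace Ω] {P : Measure Ω} [IsProbabilityMeasure P] {p q : ℝ}
  {x y : Ω → ℤ → ℕ}

lemma HasConfigLaw.map_eq_map (hxm : Measurable x) (hym : Measurable y)
    (hx : HasConfigLaw p q P x) (hy : HasConfigLaw p q P y) : P.map x = P.map y := by
  classical
  refine (map_eq_iff_forall_finset_map_restrict_eq (X := fun t ω => x ω t)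
    (Y := fun t ω => y ω t) hxm.aemeasurable hym.aemeasurable).2 fun F => ?_
  refine Measure.ext_of_singleton fun b => ?_
  have key : ∀ w : Ω → ℤ → ℕ, Measurable w → HasConfigLaw p q P w →
      (P.map fun ω => F.restrict (w ω)) {b} =
        ∏ t ∈ F, ENNReal.ofReal (markWeight p q (if h : t ∈ F then b ⟨t, h⟩ else 0)) := by
    intro w hwm hw
    rw [← hw F, Measure.map_apply (f := fun ω => F.restrict (w ω))
      ((Finset.measurable_restrict F).comp hwm) (measurableSet_singleton b)]
    congr 1
    ext ω
    simp only [Set.mem_preimage, Set.mem_singleton_iff, Set.mem_ofPred_eq, funext_iff,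
      Subtype.forall, Finset.restrict]
    exact forall₂_congr fun t ht => by rw [dif_pos ht]
  exact (key x hxm hx).trans (key y hym hy).symm

lemma HasConfigLaw.indepFun (hxm : Measurable x) (hx : HasConfigLaw p q P x) {t u : ℤ}
    (htu : t ≠ u) : IndepFun (fun ω => x ω t) (fun ω => x ω u) P := by
  have hm : ∀ t, Measurable fun ω => x ω t := fun t => (measurable_pi_apply t).comp hxm
  have h1 : ∀ t, IsProbabilityMeasure (P.map fun ω => x ω t) := fun t =>
    Measure.isProbabilityMeasure_map (hm t).aemeasurable
  rw [indepFun_iff_map_prod_eq_prod_map_map (hm t).aemeasurable (hm u).aemeasurable]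
  refine Measure.ext_of_singleton fun ⟨j, k⟩ => ?_
  have h := hx {t, u} fun v => if v = t then j else k
  rw [Finset.prod_pair htu] at h
  simp only [Finset.mem_insert, Finset.mem_singleton, forall_eq_or_imp, forall_eq, if_true,
    if_neg htu.symm] at h
  have h2 : ∀ t k, (P.map fun ω => x ω t) {k} = ENNReal.ofReal (markWeight p q k) :=
    fun t k => by
      rw [Measure.map_apply (hm t) (measurableSet_singleton k)]; exact hx.measure_eq t k
  rw [← Set.singleton_prod_singleton, Measure.prod_prod, h2, h2, ← h,
    Measure.map_apply ((hm t).prodMk (hm u))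
      ((measurableSet_singleton _).prod (measurableSet_singleton _))]
  rfl

lemma hasSum_mul_markWeight (hq0 : 0 < q) (hq : q < 1) :
    HasSum (fun k : ℕ => (k : ℝ) * markWeight p q k) (p / q) := by
  have h1 : ‖1 - q‖ < 1 := by
    rw [Real.norm_of_nonneg (by linarith)]; linarith
  have h2 := ((hasSum_coe_mul_geometric_of_norm_lt_one h1).mul_right (p * q)).add
    ((hasSum_geometricWeight hq0 hq).mul_left p)
  have e1 : (fun k : ℕ => ((k + 1 : ℕ) : ℝ) * markWeight p q (k + 1)) =
      fun k : ℕ => (k : ℝ) * (1 - q) ^ k * (p * q) + p * ((1 - q) ^ k * q) := by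
    funext k
    simp only [markWeight]; push_cast; ring
  have e2 : p / q = (1 - q) / (1 - (1 - q)) ^ 2 * (p * q) + p * 1 := by
    rw [sub_sub_cancel]
    field_simp
    ring
  rw [← e1, ← e2] at h2
  simpa using (hasSum_nat_add_iff (f := fun k : ℕ => (k : ℝ) * markWeight p q k) 1).1 h2

lemma HasConfigLaw.lintegral_eq {P : Measure Ω} (hp : 0 < p) (hpq : p < q) (hq : q < 1)
    (hxm : Measurable x) (hx : HasConfigLaw p q P x) (t : ℤ) :
    ∫⁻ ω, ENNReal.ofReal (x ω t) ∂P = ENNReal.ofReal (p / q) := by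
  have hm : Measurable fun ω => x ω t := (measurable_pi_apply t).comp hxm
  have h := hasSum_mul_markWeight (p := p) (hp.trans hpq) hq
  have hnn : ∀ k : ℕ, 0 ≤ (k : ℝ) * markWeight p q k := fun k =>
    mul_nonneg k.cast_nonneg (markWeight_nonneg hp hpq hq k)
  rw [← lintegral_map (f := fun k : ℕ => ENNReal.ofReal k) (measurable_of_countable _) hm,
    lintegral_countable', ← h.tsum_eq, ENNReal.ofReal_tsum_of_nonneg hnn h.summable]
  refine tsum_congr fun k => ?_
  rw [Measure.map_apply hm (measurableSet_singleton k), ENNReal.ofReal_mul k.cast_nonneg]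
  congr 1
  exact hx.measure_eq t k

/-- The work arriving during `[-j, 0)`, decreased by `j`, tends to `-∞`: this is the strong law of
large numbers, the mean work per time unit being `p / q < 1`. -/
lemma HasConfigLaw.ae_tendsto (hp : 0 < p) (hpq : p < q) (hq : q < 1) (hxm : Measurable x)
    (hx : HasConfigLaw p q P x) :
    ∀ᵐ ω ∂P, Tendsto (fun j : ℕ => ∑ u ∈ Finset.Ico (-(j : ℤ)) 0, ((x ω u : ℤ) - 1))
      atTop atBot := by
  have hm : ∀ t, Measurable fun ω => x ω t := fun t => (measurable_pi_apply t).comp hxm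
  have hcast : Measurable (Nat.cast : ℕ → ℝ) := measurable_of_countable _
  set X : ℕ → Ω → ℝ := fun i ω => (x ω (-(i + 1)) : ℝ) with hX
  have hXm : ∀ i, Measurable (X i) := fun i => hcast.comp (hm _)
  have hX0 : ∀ i ω, 0 ≤ X i ω := fun i ω => Nat.cast_nonneg _
  have hint : Integrable (X 0) P := by
    refine ⟨(hXm 0).aestronglyMeasurable, ?_⟩
    rw [hasFiniteIntegral_iff_ofReal (Eventually.of_forall (hX0 0)),
      hx.lintegral_eq hp hpq hq hxm]
    exact ENNReal.ofReal_lt_top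
  have hmean : P[X 0] = p / q := by
    rw [integral_eq_lintegral_of_nonneg_ae (Eventually.of_forall (hX0 0))
      (hXm 0).aestronglyMeasurable, hx.lintegral_eq hp hpq hq hxm, ENNReal.toReal_ofReal]
    exact div_nonneg hp.le (hp.trans hpq).le
  have hlln := strong_law_ae_real X hint
    (fun i j hij => (hx.indepFun hxm (by omega)).comp hcast hcast)
    (fun i => by
      refine IdentDistrib.comp (f := fun ω => x ω (-(i + 1))) (g := fun ω => x ω (-((0 : ℕ) + 1)))
        ⟨(hm _).aemeasurable, (hm _).aemeasurable, Measure.ext_of_singleton fun k => ?_⟩ hcast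
      rw [Measure.map_apply (hm _) (measurableSet_singleton k),
        Measure.map_apply (hm _) (measurableSet_singleton k)]
      exact (hx.measure_eq _ k).trans (hx.measure_eq _ k).symm)
  rw [hmean] at hlln
  filter_upwards [hlln] with ω hω
  have hsum : ∀ j : ℕ, ((∑ u ∈ Finset.Ico (-(j : ℤ)) 0, ((x ω u : ℤ) - 1) : ℤ) : ℝ) =
      ∑ i ∈ Finset.range j, X i ω - j := by
    intro j
    induction j with
    | zero => simp
    | succ j ih =>
      rw [Finset.sum_range_succ,
        ← sum_Ico_add_sum_Ico (b := -(j : ℤ)) (by push_cast; omega) (by omega)]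
      have : Finset.Ico (-((j + 1 : ℕ) : ℤ)) (-(j : ℤ)) = {-((j : ℤ) + 1)} := by
        ext u; simp only [Finset.mem_Ico, Finset.mem_singleton]; omega
      rw [this, Finset.sum_singleton, Int.cast_add, ih, hX]
      push_cast; ring
  have hlim : Tendsto (fun j : ℕ => ((∑ i ∈ Finset.range j, X i ω) / j - 1) * (j : ℝ))
      atTop atBot := by
    refine (hω.sub_const 1).neg_mul_atTop ?_ tendsto_natCast_atTop_atTop
    rw [sub_neg, div_lt_one (hp.trans hpq)]
    exact hpq
  rw [← tendsto_intCast_atBot_iff (R := ℝ)]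
  refine hlim.congr' ?_
  filter_upwards [eventually_gt_atTop 0] with j hj
  rw [hsum]
  have : (j : ℝ) ≠ 0 := by positivity
  field_simp

end FiniteDimensional

/-! ### The law of the output -/

section Output

variable {Ω : Type*} [MeasurableSpace Ω] {P : Measure Ω} [IsProbabilityMeasure P] {p q : ℝ}
  {x y : Ω → ℤ → ℕ}

/-- The finite measure on states with the stationary weights. -/
def stateMeasure (p q : ℝ) : Measure (List (ℕ × ℕ)) :=
  Measure.sum fun l => ENNReal.ofReal (stateWeight p q l) • Measure.dirac l

lemma stateMeasure_singleton (p q : ℝ) (l : List (ℕ × ℕ)) :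
    stateMeasure p q {l} = ENNReal.ofReal (stateWeight p q l) := by
  rw [stateMeasure, Measure.sum_apply _ (measurableSet_singleton l), tsum_eq_single l]
  · simp
  · intro l' h
    simp [h]

lemma stateMeasure_univ (p q : ℝ) :
    stateMeasure p q Set.univ = ∑' l, ENNReal.ofReal (stateWeight p q l) := by
  rw [stateMeasure, Measure.sum_apply _ MeasurableSet.univ]
  simp

/-- If the queue fed with an i.i.d. configuration `x`, when empty at a clearing time, outputs `y`
from then on, then `y` has the same law as `x`. Start the queue at time `-j` from a random state
with the stationary weights: its outputs are i.i.d. by `HasProductLaw.sweep`. For `j` large it is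
empty at a fixed clearing time, and from then on its outputs are those of `y`. -/
lemma HasConfigLaw.of_sweep (hp : 0 < p) (hpq : p < q) (hq : q < 1)
    (hxm : Measurable x) (hym : Measurable y) (hx : HasConfigLaw p q P x)
    (H : ∀ᵐ ω ∂P, ∀ T, IsClearingTime (x ω) T → ∀ z : List (ℕ × ℕ) × (ℤ → ℕ), z.1 = [] →
      (∀ t, T ≤ t → z.2 t = x ω t) → ∀ i : ℕ, ∀ t, T ≤ t → t < T + i →
        (sweep T i z).2 t = y ω (t + 1)) :
    HasConfigLaw p q P y := by
  set c := ∑' l : List (ℕ × ℕ), ENNReal.ofReal (stateWeight p q l) with hc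
  have hctop : c ≠ ⊤ := tsum_stateWeight_ne_top hp hpq hq
  have hc0 : c ≠ 0 := fun h => by
    have := ENNReal.tsum_eq_zero.1 h []
    simp [stateWeight] at this
  have : IsFiniteMeasure (stateMeasure p q) := ⟨by
    rw [stateMeasure_univ]; exact hctop.lt_top⟩
  set Q := P.prod (stateMeasure p q) with hQ
  set Z : Ω × List (ℕ × ℕ) → List (ℕ × ℕ) × (ℤ → ℕ) := fun ω => (ω.2, x ω.1) with hZ
  have hZm : Measurable Z := measurable_snd.prodMk (hxm.comp measurable_fst)
  have hZlaw : HasProductLaw p q Q Z := by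
    intro F l b
    have : {ω | (Z ω).1 = l ∧ ∀ t ∈ F, (Z ω).2 t = b t} =
        {ω | ∀ t ∈ F, x ω t = b t} ×ˢ {l} := by
      ext ω
      simp only [hZ, Set.mem_ofPred_eq, Set.mem_prod, Set.mem_singleton_iff, and_comm]
    rw [this, hQ, Measure.prod_prod, hx, stateMeasure_singleton, mul_comm]
  have key : ∀ (F : Finset ℤ) (b : ℤ → ℕ), P {ω | ∀ t ∈ F, y ω (t + 1) = b t} =
      ∏ t ∈ F, ENNReal.ofReal (markWeight p q (b t)) := by
    intro F b
    have hS : MeasurableSet {ω : Ω × List (ℕ × ℕ) | ∀ t ∈ F, y ω.1 (t + 1) = b t} :=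
      measurableSet_forall_mem_eq (x := fun (ω : Ω × List (ℕ × ℕ)) t => y ω.1 (t + 1))
        (measurable_pi_lambda _ fun t => (measurable_pi_apply (t + 1)).comp
          (hym.comp measurable_fst)) F b
    have hsw : ∀ j : ℕ, Measurable fun ω => sweep (-(j : ℤ)) (2 * j) (Z ω) := fun j =>
      (measurable_sweep _ _).comp hZm
    have hlim := tendsto_measure_of_ae_tendsto_indicator_of_isFiniteMeasure (μ := Q) (L := atTop)
      (As := fun j : ℕ => {ω | ∀ t ∈ F, (sweep (-(j : ℤ)) (2 * j) (Z ω)).2 t = b t}) hS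
      (fun j => measurableSet_forall_mem_eq (measurable_snd.comp (hsw j)) F b) (by
        have hae : ∀ᵐ ω ∂Q, _ := Measure.quasiMeasurePreserving_fst.ae
          (H.and (hx.ae_tendsto hp hpq hq hxm))
        filter_upwards [hae] with ω ⟨h1, h2⟩
        obtain ⟨N, hN⟩ := F.bddBelow
        obtain ⟨M, hM⟩ := F.bddAbove
        obtain ⟨T, hTN, hT⟩ := exists_isClearingTime h2 (min N 0)
        filter_upwards [eventually_sum_le h2 (show T ≤ 0 by omega) (load ω.2),
          eventually_ge_atTop T.natAbs, eventually_gt_atTop M.natAbs] with j hj hjT hjM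
        refine forall₂_congr fun t ht => ?_
        have ht1 : N ≤ t := hN ht
        have ht2 : t ≤ M := hM ht
        -- The steps from `-j` to `j` are split at the clearing time `T`.
        have hm : -(j : ℤ) + ((T + j).toNat : ℕ) = T := by omega
        have hadd : 2 * j = (T + j).toNat + (j - T).toNat := by omega
        rw [hadd, sweep_add, hm, h1 T hT _ (sweep_fst_eq_nil hT _ _ hm _ hj)
          (fun t ht => sweep_snd_of_le _ _ _ _ (by omega)) _ t (by omega) (by omega)])
    have hconst : ∀ j : ℕ, Q {ω | ∀ t ∈ F, (sweep (-(j : ℤ)) (2 * j) (Z ω)).2 t = b t} =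
        c * ∏ t ∈ F, ENNReal.ofReal (markWeight p q (b t)) := fun j =>
      (hZlaw.sweep hp hpq hq hZm (-(j : ℤ)) (2 * j)).measure_snd (hsw j) F b
    simp only [hconst] at hlim
    have heq := tendsto_nhds_unique hlim tendsto_const_nhds
    have hprod : {ω : Ω × List (ℕ × ℕ) | ∀ t ∈ F, y ω.1 (t + 1) = b t} =
        {ω | ∀ t ∈ F, y ω (t + 1) = b t} ×ˢ Set.univ := by
      ext ω; simp
    rw [hprod, hQ, Measure.prod_prod, stateMeasure_univ, mul_comm] at heq
    exact (ENNReal.mul_right_inj hc0 hctop).1 heq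
  intro F b
  -- `sweep` stores the departure at time `t + 1` at coordinate `t`, hence the shift by one.
  have h := key (F.image fun t => t - 1) fun t => b (t + 1)
  rw [Finset.prod_image (by intro a _ b _ h; simpa using h)] at h
  simpa using h

end Output

/-! ### Counting measures -/

/-- The counting measure of the marked points of a configuration. -/
def configMeasure (x : ℤ → ℕ) : Measure (ℝ × ℝ) :=
  Measure.sum fun t : ℤ => if x t = 0 then 0 else Measure.dirac ((t : ℝ), (x t : ℝ))

lemma measurable_configMeasure : Measurable configMeasure := by
  refine Measure.measurable_of_measurable_coe _ fun S hS => ?_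
  simp only [configMeasure, Measure.sum_apply _ hS]
  refine Measurable.tsum fun t => ?_
  exact (measurable_of_countable fun k : ℕ =>
    (if k = 0 then 0 else Measure.dirac ((t : ℝ), (k : ℝ)) : Measure (ℝ × ℝ)) S).comp
      (measurable_pi_apply t)

lemma markedCounting_eq {A c : ℤ → ℝ} {B : ℤ → ℤ} {m : ℤ → ℕ} (hB : StrictMono B)
    (hA : A = fun n => (B n : ℝ)) (hc : c = fun n => (m n : ℝ)) (hm : ∀ n, m n ≠ 0) :
    markedCounting A c = configMeasure (config A c) := by
  have hAinj : Function.Injective A := by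
    rw [hA]; exact Int.cast_injective.comp hB.injective
  have hval : ∀ n, config A c (B n) = m n := fun n =>
    config_apply hAinj (congrFun hA n) (congrFun hc n)
  refine Measure.ext fun S hS => ?_
  rw [markedCounting, configMeasure, Measure.sum_apply _ hS, Measure.sum_apply _ hS]
  refine Eq.trans ?_ (hB.injective.tsum_eq (f := fun t : ℤ => (if config A c t = 0 then 0 else
    Measure.dirac ((t : ℝ), (config A c t : ℝ)) : Measure (ℝ × ℝ)) S) ?_)
  · refine tsum_congr fun n => ?_
    rw [hval, if_neg (hm n), hA, hc]
  · intro t ht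
    by_contra hne
    refine ht ?_
    have : config A c t = 0 := config_of_ne fun n hn => hne ⟨n, by
      have h : (B n : ℝ) = t := (congrFun hA n).symm.trans hn
      exact_mod_cast h⟩
    simp [this]

lemma tendsto_cast_of_strictMono {B : ℤ → ℤ} (hB : StrictMono B) :
    Tendsto (fun n => (B n : ℝ)) atTop atTop ∧ Tendsto (fun n => (B n : ℝ)) atBot atBot := by
  constructor
  · refine tendsto_intCast_atTop_atTop.comp (tendsto_atTop.2 fun b => ?_)
    filter_upwards [eventually_ge_atTop (max 0 (b - B 0))] with n hn
    have := add_sub_le_of_strictMono hB (show 0 ≤ n by omega)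
    omega
  · refine (tendsto_intCast_atBot_iff (R := ℝ)).2 (tendsto_atBot.2 fun b => ?_)
    filter_upwards [eventually_le_atBot (min 0 (b - B 0))] with n hn
    have := add_sub_le_of_strictMono hB (show n ≤ 0 by omega)
    omega

/-- The deterministic part of the theorem, for integer points `B n`, integer service times
`σ n + 1` and a walk that drifts to `-∞`. -/
lemma output_properties {A s : ℤ → ℝ} {B : ℤ → ℤ} {σ : ℤ → ℕ} (hB : StrictMono B)
    (hA : A = fun n => (B n : ℝ)) (hs : s = fun n => (σ n : ℝ) + 1)
    (hlim : Tendsto (fun j : ℕ => ∑ u ∈ Finset.Ico (-(j : ℤ)) 0, ((config A s u : ℤ) - 1))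
      atTop atBot) :
    (DeparturesFinite A s ∧ IsMarkedPointSequence (departure A s) (backTime A s)) ∧
    markedCounting A s = configMeasure (config A s) ∧
    markedCounting (departure A s) (backTime A s) =
      configMeasure (config (departure A s) (backTime A s)) ∧
    ∀ T, IsClearingTime (config A s) T → ∀ z : List (ℕ × ℕ) × (ℤ → ℕ), z.1 = [] →
      (∀ t, T ≤ t → z.2 t = config A s t) → ∀ i : ℕ, ∀ t, T ≤ t → t < T + i →
        (sweep T i z).2 t = config (departure A s) (backTime A s) (t + 1) := by
  have hs' : s = fun n => ((σ n + 1 : ℕ) : ℝ) := by rw [hs]; push_cast; rfl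
  have hAinj : Function.Injective A := by
    rw [hA]; exact Int.cast_injective.comp hB.injective
  have hx : ∀ n, config A s (B n) = σ n + 1 := fun n =>
    config_apply hAinj (congrFun hA n) (congrFun hs' n)
  have hx0 : ∀ t, (∀ n, B n ≠ t) → config A s t = 0 := fun t ht =>
    config_of_ne fun n hn => ht n (by
      have h : (B n : ℝ) = t := (congrFun hA n).symm.trans hn
      exact_mod_cast h)
  have hT := exists_isClearingTime hlim
  have hfin : DeparturesFinite A s := by
    rw [hA, hs]; exact departuresFinite hB hx hT
  obtain ⟨E, hE, hD⟩ := exists_isIntegerDeparture hB hx hT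
  rw [← hA, ← hs] at hD
  have hEm := hE.strictMono
  have hBE : ∀ n, B n < E n := fun n => by have := hE.eq_max_add n; omega
  have hBB : ∀ n, B n < B (n + 1) := fun n => hB (by omega)
  have hr : backTime A s = fun n => ((min (E n) (B (n + 1)) - B n).toNat : ℝ) := by
    funext n
    have h : ((min (E n) (B (n + 1)) - B n).toNat : ℤ) = min (E n) (B (n + 1)) - B n :=
      Int.toNat_of_nonneg (by have := hBE n; have := hBB n; omega)
    rw [backTime, hD, hA]
    have h' : (((min (E n) (B (n + 1)) - B n).toNat : ℤ) : ℝ) =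
      ((min (E n) (B (n + 1)) - B n : ℤ) : ℝ) := by rw [h]
    push_cast at h'
    rw [← h']
  have hr0 : ∀ n, (min (E n) (B (n + 1)) - B n).toNat ≠ 0 := fun n => by
    have := hBE n; have := hBB n; omega
  have hDinj : Function.Injective (departure A s) := by
    rw [hD]; exact Int.cast_injective.comp hEm.injective
  refine ⟨⟨hfin, ?_⟩, markedCounting_eq hB hA hs' fun n => by omega,
    markedCounting_eq hEm hD hr hr0, ?_⟩
  · refine ⟨?_, ?_, ?_, fun n => ?_⟩
    · rw [hD]; exact Int.cast_strictMono.comp hEm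
    · rw [hD]; exact (tendsto_cast_of_strictMono hEm).1
    · rw [hD]; exact (tendsto_cast_of_strictMono hEm).2
    · rw [hr]; exact Nat.cast_pos.2 (Nat.pos_of_ne_zero (hr0 n))
  · intro T hT z hz hzx i
    refine sweep_eq_of_isClearingTime hB hx hx0 hE hT (fun n => ?_) (fun t ht => ?_) hz hzx i
    · rw [config_apply hDinj (congrFun hD n) (congrFun hr n)]
      have := hBE n; have := hBB n; omega
    · refine config_of_ne fun n hn => ht n ?_
      have h : (E n : ℝ) = t := (congrFun hD n).symm.trans hn
      exact_mod_cast h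

/-! ### Measurability of the output -/

lemma measurable_departure {Ω : Type*} [MeasurableSpace Ω] {A s : ℤ → Ω → ℝ}
    (hA : ∀ n, Measurable (A n)) (hs : ∀ n, Measurable (s n)) (n : ℤ) :
    Measurable fun ω => departure (fun n => A n ω) (fun n => s n ω) n := by
  refine Measurable.iSup fun k => ?_
  exact (hA k).add (Finset.measurable_sum _ fun i _ => hs i)

lemma measurable_backTime {Ω : Type*} [MeasurableSpace Ω] {A s : ℤ → Ω → ℝ}
    (hA : ∀ n, Measurable (A n)) (hs : ∀ n, Measurable (s n)) (n : ℤ) :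
    Measurable fun ω => backTime (fun n => A n ω) (fun n => s n ω) n :=
  ((measurable_departure hA hs n).min (hA (n + 1))).sub (hA n)

end GeomQueue

end

open GeomQueue in
theorem theorem2 {Ω : Type*} [MeasurableSpace Ω] (P : Measure Ω) [IsProbabilityMeasure P]
    (p q : ℝ) (hp : 0 < p) (hpq : p < q) (hq : q < 1)
    (A s : ℤ → Ω → ℝ)
    (hA : GeomQueue.IsBernoulliPointProcess P p A)
    (hs : GeomQueue.IsGeometricIID P q s)
    (hAs : IndepFun (fun ω n => A n ω) (fun ω n => s n ω) P) :
    -- the departure times are almost surely finite and the output is a marked point process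
    (∀ᵐ ω ∂P, GeomQueue.DeparturesFinite (fun n => A n ω) (fun n => s n ω) ∧
      GeomQueue.IsMarkedPointSequence
        (GeomQueue.departure (fun n => A n ω) (fun n => s n ω))
        (GeomQueue.backTime (fun n => A n ω) (fun n => s n ω))) ∧
    -- the output has the same law as the input
    IdentDistrib
      (fun ω => GeomQueue.markedCounting
        (GeomQueue.departure (fun n => A n ω) (fun n => s n ω))
        (GeomQueue.backTime (fun n => A n ω) (fun n => s n ω)))
      (fun ω => GeomQueue.markedCounting (fun n => A n ω) (fun n => s n ω))
      P P := by
  have hDm := measurable_departure hA.measurable hs.measurable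
  have hrm := measurable_backTime hA.measurable hs.measurable
  obtain ⟨x, hx⟩ : ∃ x : Ω → ℤ → ℕ, x = fun ω => config (fun n => A n ω) (fun n => s n ω) :=
    ⟨_, rfl⟩
  obtain ⟨y, hy⟩ : ∃ y : Ω → ℤ → ℕ, y = fun ω => config
      (departure (fun n => A n ω) (fun n => s n ω)) (backTime (fun n => A n ω) (fun n => s n ω)) :=
    ⟨_, rfl⟩
  have hxm : Measurable x := by
    rw [hx]
    exact measurable_config_comp hA.measurable hs.measurable
  have hym : Measurable y := by
    rw [hy]
    exact measurable_config_comp hDm hrm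
  have hxlaw : HasConfigLaw p q P x := by
    rw [hx]
    exact measure_config hp hpq hq hA hs hAs
  have hae : ∀ᵐ ω ∂P, (DeparturesFinite (fun n => A n ω) (fun n => s n ω) ∧
      IsMarkedPointSequence (departure (fun n => A n ω) (fun n => s n ω))
        (backTime (fun n => A n ω) (fun n => s n ω))) ∧
      markedCounting (fun n => A n ω) (fun n => s n ω) = configMeasure (x ω) ∧
      markedCounting (departure (fun n => A n ω) (fun n => s n ω))
        (backTime (fun n => A n ω) (fun n => s n ω)) = configMeasure (y ω) ∧
      ∀ T, IsClearingTime (x ω) T → ∀ z : List (ℕ × ℕ) × (ℤ → ℕ), z.1 = [] →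
        (∀ t, T ≤ t → z.2 t = x ω t) → ∀ i : ℕ, ∀ t, T ≤ t → t < T + i →
          (sweep T i z).2 t = y ω (t + 1) := by
    filter_upwards [hA.ae_exists_int, hs.ae_exists_nat (hp.trans hpq) hq,
      hxlaw.ae_tendsto hp hpq hq hxm] with ω ⟨B, hB, hAB⟩ ⟨σ, hσ⟩ hlim
    rw [hx] at hlim
    rw [hx, hy]
    exact output_properties hB hAB hσ hlim
  have hylaw : HasConfigLaw p q P y :=
    HasConfigLaw.of_sweep hp hpq hq hxm hym hxlaw (hae.mono fun ω h => h.2.2.2)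
  refine ⟨hae.mono fun ω h => h.1, ?_⟩
  have hmap : P.map (fun ω => configMeasure (y ω)) = P.map (fun ω => configMeasure (x ω)) := by
    rw [← Function.comp_def, ← Function.comp_def, ← Measure.map_map measurable_configMeasure hym,
      ← Measure.map_map measurable_configMeasure hxm, hylaw.map_eq_map hym hxm hxlaw]
  have hcx : (fun ω => markedCounting (fun n => A n ω) (fun n => s n ω)) =ᵐ[P]
      fun ω => configMeasure (x ω) := hae.mono fun ω h => h.2.1
  have hcy : (fun ω => markedCounting (departure (fun n => A n ω) (fun n => s n ω))
      (backTime (fun n => A n ω) (fun n => s n ω))) =ᵐ[P] fun ω => configMeasure (y ω) :=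
    hae.mono fun ω h => h.2.2.1
  exact ⟨(measurable_configMeasure.comp hym).aemeasurable.congr hcy.symm,
    (measurable_configMeasure.comp hxm).aemeasurable.congr hcx.symm,
    by rw [Measure.map_congr hcy, Measure.map_congr hcx, hmap]⟩
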